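/- Let ${\mathcal L}=\{L_1,\dots,L_n\}$ be a simple arrangement of $n$ pseudolines in the real projective plane ${\bf R}P^2$: each $L_i$ is a simple smooth closed curve (smoothly) isotopic to a projective line, any two distinct $L_i,L_j$ intersect transversally in exactly one point, and no three of the curves have a common point. For $i\neq j$ the two connected components of ${\bf R}P^2\setminus(L_i\cup L_j)$ are called the digons of $L_i$ and $L_j$; each of them has the two sides $L_i$, $L_j$ and has two corners, both at the point $L_i\cap L_j$. If $L_i$ and $L_j$ are oriented, there is exactly one digon $D^o$ on whose boundary they induce an orientation, i.e. such that at each of the two corners of $D^o$ one of the two oriented sides arrives and the other one departs. The orientations of $L_i$ and $L_j$ are called compatible at $L_i\cap L_j$ if the number $\alpha^o$ of intersections $L_s\cap L_t$ (with $L_s\neq L_t$ both in ${\mathcal L}\setminus\{L_i,L_j\}$) that are contained in $D^o$ satisfies $$\alpha^o\equiv\binom{n-3}{2}\pmod 2 .$$ An orientation of all pseudolines of ${\mathcal L}$ is compatible if it is compatible at $L_i\cap L_j$ for all $L_i\neq L_j$. Theorem. If $\binom{n-2}{2}$ is odd (where $\binom{m}{2}=0$ for $m<2$, so that $n\geq 4$),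 then there exist exactly two compatible orientations of all pseudolines of ${\mathcal L}$, and these two compatible orientations induce opposite orientations on every pseudoline of ${\mathcal L}$. -/

import Mathlib

open Set Filter Topology
open scoped Manifold ContDiff LinearAlgebra.Projectivization

noncomputable section

/-- The real projective plane, as the set of lines through the origin of `ℝ³`. -/
abbrev RP2 : Type := ℙ ℝ (Fin 3 → ℝ)

namespace RP2

/-- The point `[v]` of the projective plane with homogeneous coordinates `v ≠ 0`. -/
def proj (v : {v : Fin 3 → ℝ // v ≠ 0}) : RP2 := Projectivization.mk' ℝ v

/-- The quotient topology. -/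
instance instTopologicalSpaceRP2 : TopologicalSpace RP2 :=
  TopologicalSpace.coinduced proj inferInstance

/-- The affine coordinates `(v_a / v_k, v_b / v_k)` of `[v]`, with `a < b` the two indices
other than `k`. -/
def affineCoord (k : Fin 3) (p : RP2) : EuclideanSpace ℝ (Fin 2) :=
  Projectivization.lift
    (fun v : {v : Fin 3 → ℝ // v ≠ 0} => WithLp.toLp 2 fun l : Fin 2 => v.1 (k.succAbove l) / v.1 k)
    (by
      intro a b t h
      have ht : t ≠ 0 := by
        rintro rfl
        exact a.2 (by simpa using h)
      ext l
      simp [h, mul_div_mul_left _ _ ht]) p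

/-- The affine patch of the points `[v]` with `v_k ≠ 0`. -/
def patch (k : Fin 3) : Set RP2 := {p | p.rep k ≠ 0}

/-- The vector with `k`-th coordinate `1` whose other coordinates are those of `w`. -/
def insertOne (k : Fin 3) (w : EuclideanSpace ℝ (Fin 2)) : Fin 3 → ℝ :=
  k.insertNth (α := fun _ => ℝ) 1 (fun l => w l)

theorem insertOne_ne_zero (k : Fin 3) (w : EuclideanSpace ℝ (Fin 2)) : insertOne k w ≠ 0 := by
  intro h
  have := congrFun h k
  simp [insertOne] at this

theorem continuous_proj : Continuous proj := continuous_coinduced_rng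

theorem proj_eq_iff (v w : {v : Fin 3 → ℝ // v ≠ 0}) :
    proj v = proj w ↔ ∃ a : ℝ, a • w.1 = v.1 :=
  Projectivization.mk_eq_mk_iff' ℝ v.1 w.1 v.2 w.2

theorem mem_patch_proj (k : Fin 3) (v : {v : Fin 3 → ℝ // v ≠ 0}) :
    proj v ∈ patch k ↔ v.1 k ≠ 0 := by
  obtain ⟨a, ha⟩ := Projectivization.exists_smul_eq_mk_rep ℝ v.1 v.2
  have h : (proj v).rep = a • v.1 := ha.symm
  have ha0 : (a : ℝ) ≠ 0 := a.ne_zero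
  simp [patch, h, Units.smul_def]

theorem affineCoord_proj (k : Fin 3) (v : {v : Fin 3 → ℝ // v ≠ 0}) :
    affineCoord k (proj v) = WithLp.toLp 2 fun l : Fin 2 => v.1 (k.succAbove l) / v.1 k := rfl

theorem exists_proj_eq (p : RP2) : ∃ v, proj v = p :=
  ⟨⟨p.rep, p.rep_nonzero⟩, p.mk_rep⟩

theorem isOpen_patch (k : Fin 3) : IsOpen (patch k) := by
  rw [isOpen_coinduced]
  have : proj ⁻¹' patch k = {v : {v : Fin 3 → ℝ // v ≠ 0} | v.1 k ≠ 0} := by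
    ext v
    exact mem_patch_proj k v
  rw [this]
  exact isOpen_ne_fun ((continuous_apply k).comp continuous_subtype_val) continuous_const

theorem continuous_insertOne (k : Fin 3) : Continuous (insertOne k) := by
  refine continuous_pi fun j => ?_
  rcases Fin.eq_self_or_eq_succAbove k j with rfl | ⟨l, rfl⟩
  · simpa [insertOne] using continuous_const
  · simp only [insertOne, Fin.insertNth_apply_succAbove]
    fun_prop

/-- The `k`-th affine chart of the projective plane. -/
def affineChart (k : Fin 3) : OpenPartialHomeomorph RP2 (EuclideanSpace ℝ (Fin 2)) where
  toFun := affineCoord k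
  invFun w := proj ⟨insertOne k w, insertOne_ne_zero k w⟩
  source := patch k
  target := univ
  map_source' _ _ := mem_univ _
  map_target' w _ := by
    rw [mem_patch_proj]
    simp [insertOne]
  left_inv' p hp := by
    obtain ⟨v, rfl⟩ := exists_proj_eq p
    rw [mem_patch_proj] at hp
    rw [proj_eq_iff]
    refine ⟨(v.1 k)⁻¹, ?_⟩
    funext j
    rcases Fin.eq_self_or_eq_succAbove k j with rfl | ⟨l, rfl⟩
    · simp [insertOne, hp]
    · simp [insertOne, affineCoord_proj, div_eq_inv_mul]
  right_inv' w _ := by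
    rw [affineCoord_proj]
    ext l
    simp [insertOne]
  open_source := isOpen_patch k
  open_target := isOpen_univ
  continuousOn_toFun := by
    have hq : IsQuotientMap proj := ⟨⟨rfl⟩, exists_proj_eq⟩
    rw [hq.continuousOn_isOpen_iff (isOpen_patch k)]
    have h : ContinuousOn (fun v : {v : Fin 3 → ℝ // v ≠ 0} =>
        (WithLp.toLp 2 fun l : Fin 2 => v.1 (k.succAbove l) / v.1 k : EuclideanSpace ℝ (Fin 2)))
        (proj ⁻¹' patch k) := by
      refine (PiLp.continuous_toLp 2 _).comp_continuousOn (continuousOn_pi.2 fun l => ?_)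
      refine ContinuousOn.div ?_ ?_ fun v hv => (mem_patch_proj k v).1 hv
      · exact ((continuous_apply _).comp continuous_subtype_val).continuousOn
      · exact ((continuous_apply _).comp continuous_subtype_val).continuousOn
    exact h
  continuousOn_invFun :=
    (continuous_proj.comp ((continuous_insertOne k).subtype_mk _)).continuousOn

theorem exists_mem_patch (p : RP2) : ∃ k, p ∈ patch k := by
  by_contra! h
  exact p.rep_nonzero (funext fun k => by simpa [patch] using h k)

/-- The atlas of the three affine charts. -/
instance instChartedSpaceRP2 : ChartedSpace (EuclideanSpace ℝ (Fin 2)) RP2 where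
  atlas := range affineChart
  chartAt p := affineChart (exists_mem_patch p).choose
  mem_chart_source p := (exists_mem_patch p).choose_spec
  chart_mem_atlas _ := mem_range_self _

/-- The standard smooth structure of the projective plane. -/
instance instIsManifoldRP2 : IsManifold (𝓡 2) ∞ RP2 := by
  refine isManifold_of_contDiffOn (𝓡 2) ∞ RP2 ?_
  rintro _ _ ⟨k, rfl⟩ ⟨m, rfl⟩
  have hcoord : ∀ j : Fin 3, ContDiff ℝ ∞ fun w : EuclideanSpace ℝ (Fin 2) => insertOne k w j := by
    intro j
    rcases Fin.eq_self_or_eq_succAbove k j with rfl | ⟨l, rfl⟩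
    · simpa [insertOne] using contDiff_const
    · simp only [insertOne, Fin.insertNth_apply_succAbove]
      fun_prop
  have h : ContDiffOn ℝ ∞ (fun w : EuclideanSpace ℝ (Fin 2) =>
      (WithLp.toLp 2 fun l : Fin 2 => insertOne k w (m.succAbove l) / insertOne k w m :
        EuclideanSpace ℝ (Fin 2))) {w | insertOne k w m ≠ 0} := by
    refine (PiLp.contDiff_toLp (𝕜 := ℝ) (p := 2)).comp_contDiffOn (contDiffOn_pi.2 fun l => ?_)
    exact (hcoord _).contDiffOn.div (hcoord _).contDiffOn fun w hw => hw
  refine ContDiffOn.mono h ?_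
  rintro w ⟨hw, -⟩
  have hw2 : proj ⟨insertOne k w, insertOne_ne_zero k w⟩ ∈ patch m := hw.2
  exact (mem_patch_proj m _).1 hw2

/-- The projective line of the points `[v]` with `a ⬝ v = 0`. -/
def projLine (a : Fin 3 → ℝ) : Set RP2 := {p | a ⬝ᵥ p.rep = 0}

/-- The velocity at time `t` of a curve in the projective plane. -/
def velocity (c : ℝ → RP2) (t : ℝ) : TangentSpace (𝓡 2) (c t) :=
  mfderiv 𝓘(ℝ, ℝ) (𝓡 2) c t (1 : ℝ)

end RP2

open RP2

/-- A pseudoline: a subset of the projective plane to which some projective line is carried by a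
smooth ambient isotopy, that is, by the end of a smooth family `Φ t`, `0 ≤ t ≤ 1`, of
diffeomorphisms of the projective plane that starts at the identity. -/
def IsPseudoline (L : Set RP2) : Prop :=
  ∃ Φ : ℝ → Diffeomorph (𝓡 2) (𝓡 2) RP2 RP2 ∞, ∃ a : Fin 3 → ℝ, a ≠ 0 ∧
    ContMDiffOn (𝓘(ℝ, ℝ).prod (𝓡 2)) (𝓡 2) ∞ (fun q : ℝ × RP2 => Φ q.1 q.2) (Icc 0 1 ×ˢ univ) ∧
    (∀ p, Φ 0 p = p) ∧ Φ 1 '' projLine a = L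

/-- The tangent space at `p` of a subset `L` of the projective plane (for a smooth curve `L`
through `p`: its tangent line), spanned by the velocities of the smooth curves in `L`. -/
def tangentSpan (L : Set RP2) (p : RP2) : Submodule ℝ (TangentSpace (𝓡 2) p) :=
  Submodule.span ℝ {u | ∃ c : ℝ → RP2, ContMDiff 𝓘(ℝ, ℝ) (𝓡 2) ∞ c ∧ (∀ t, c t ∈ L) ∧
    ∃ h : c 0 = p, u = h ▸ velocity c 0}

/-- A simple arrangement of `n` pseudolines. -/
structure IsSimpleArrangement {n : ℕ} (L : Fin n → Set RP2) : Prop where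
  pseudoline : ∀ i, IsPseudoline (L i)
  /-- Two of the pseudolines meet in exactly one point. -/
  meet_once : ∀ i j, i ≠ j → ∃ p, L i ∩ L j = {p}
  /-- They are transversal there. -/
  transversal : ∀ i j, i ≠ j → ∀ p ∈ L i ∩ L j, tangentSpan (L i) p ⊔ tangentSpan (L j) p = ⊤
  /-- There are no triple intersections. -/
  simple : ∀ i j k, i ≠ j → j ≠ k → i ≠ k → L i ∩ L j ∩ L k = ∅

/-- An orientation of a curve `L` in the projective plane: a direction (an open half-line of the
tangent plane) at every point of `L`, these being the directions of motion of a point that runs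
through `L` smoothly and without ever stopping. -/
structure CurveOrientation (L : Set RP2) where
  dir : ∀ p : L, Module.Ray ℝ (TangentSpace (𝓡 2) p.1)
  exists_param : ∃ γ : ℝ → RP2, ContMDiff 𝓘(ℝ, ℝ) (𝓡 2) ∞ γ ∧ range γ = L ∧
    ∀ (t : ℝ) (h : γ t ∈ L), ∃ hv : velocity γ t ≠ 0, dir ⟨γ t, h⟩ = rayOfNeZero ℝ (velocity γ t) hv

/-- A digon of two curves: a connected component of the complement of their union. -/
def IsDigon (L M D : Set RP2) : Prop :=
  ∃ x ∈ (L ∪ M)ᶜ, D = connectedComponentIn (L ∪ M)ᶜ x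

/-- The set `D` has a corner at `p` with sides leaving `p` in the directions `r` and `s`: every
smooth curve that leaves `p` strictly between these two directions runs in `D` at first. -/
def HasCorner (D : Set RP2) (p : RP2) (r s : Module.Ray ℝ (TangentSpace (𝓡 2) p)) : Prop :=
  ∀ c : ℝ → RP2, ContMDiff 𝓘(ℝ, ℝ) (𝓡 2) ∞ c → ∀ h : c 0 = p,
    (∃ (u v : TangentSpace (𝓡 2) p) (hu : u ≠ 0) (hv : v ≠ 0),
      rayOfNeZero ℝ u hu = r ∧ rayOfNeZero ℝ v hv = s ∧ h ▸ velocity c 0 = u + v) →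
    ∀ᶠ t in 𝓝[>] (0 : ℝ), c t ∈ D

/-- The oriented curves `L`, `M` induce an orientation on the boundary of the digon `D`: going
round `D`, at each of its two corners (both of which are at the crossing point) one of the two
oriented sides arrives and the other one departs. So one corner lies between the forward
direction of `L` and the backward direction of `M`, the other one between the backward direction
of `L` and the forward direction of `M`. -/
def InducesBoundaryOrientation {L M : Set RP2} (o : CurveOrientation L) (o' : CurveOrientation M)
    (D : Set RP2) : Prop :=
  ∀ (p : RP2) (hL : p ∈ L) (hM : p ∈ M),
    HasCorner D p (o.dir ⟨p, hL⟩) (-o'.dir ⟨p, hM⟩) ∧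
    HasCorner D p (-o.dir ⟨p, hL⟩) (o'.dir ⟨p, hM⟩)

open Classical in
/-- The number of intersections `L s ∩ L t`, with `s ≠ t` both different from `i` and `j`, that are
contained in `D`. -/
def crossingCount {n : ℕ} (L : Fin n → Set RP2) (i j : Fin n) (D : Set RP2) : ℕ :=
  (Finset.univ.filter fun st : Fin n × Fin n =>
    st.1 < st.2 ∧ st.1 ≠ i ∧ st.1 ≠ j ∧ st.2 ≠ i ∧ st.2 ≠ j ∧ L st.1 ∩ L st.2 ⊆ D).card

/-- The orientations of `L i` and `L j` are compatible at `L i ∩ L j`: the number of crossings in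
the digon on whose boundary they induce an orientation is congruent to `(n - 3).choose 2`
modulo `2`. -/
def CompatibleAt {n : ℕ} (L : Fin n → Set RP2) (o : ∀ i, CurveOrientation (L i))
    (i j : Fin n) : Prop :=
  ∃ D, IsDigon (L i) (L j) D ∧ InducesBoundaryOrientation (o i) (o j) D ∧
    crossingCount L i j D ≡ (n - 3).choose 2 [MOD 2]

/-- A compatible orientation of all the pseudolines of an arrangement. -/
def IsCompatible {n : ℕ} (L : Fin n → Set RP2) (o : ∀ i, CurveOrientation (L i)) : Prop :=
  ∀ i j, i ≠ j → CompatibleAt L o i j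

end

/-! Everything is reduced to signs. A pseudoline is the image of a projective line under the end of
an isotopy that starts at the identity. Lifted to the sphere and coned off, this end becomes a
homogeneous homeomorphism of ℝ³ (`exists_homogeneous_lift`). So `L i` acquires a continuous defining
function f_i on ℝ³ with f_i(tv) = t f_i(v), and a closed curve λ_i on its cone with λ_i(t + π) =
-λ_i(t). As `L i` and `L j` meet once, f_j ∘ λ_i is pointwise a positive multiple of sin(t - θ_ij)
(`exists_f_lift_eq`). Put x_ij = λ_i(θ_ij), let σ_ijk be the sign of f_k(x_ij) and κ_ij the sign of
r in x_ij = r x_ji. Then σ_ijk = -σ_ikj and σ_ijk = κ_ij σ_jik (`isSignSystem`), which forces κ_ij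
κ_jk κ_ik = -1 (`prod_kappa`).

The digons of `L i` and `L j` are the two sets where f_i f_j has a fixed sign (`isDigon_iff`), and
an orientation of `L i` is a sign b_i relative to λ_i (`exists_orient_eq`). By transversality, the
digon with an induced boundary orientation is the one of sign -κ_ij b_i b_j
(`inducesBoundaryOrientation_iff`).

Let E_ij be the product of σ_sti σ_stj over all pairs s, t avoiding i, j. The number of these pairs,
`(n - 2).choose 2`, is odd, so the digon of sign ε contains N crossings with (-1)^N = -ε E_ij. Hence
compatibility at i, j says b_i b_j = m_ij with m_ij = (-1)^C(n-3,2) κ_ij E_ij. Such a system has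
exactly two solutions ±b as soon as m_ij m_jk m_ik = 1 (`exists_two_potentials`). In E_ij E_jk E_ik
the pairs avoiding i, j, k cancel, and each of the other n - 3 curves contributes -1 (`prod_sides`).
So the cocycle product is -(-1)^(C(n-3,2) + (n-3)) = -(-1)^C(n-2,2) = 1, again by oddness. -/

noncomputable section

/-! ### Homogeneous coordinates, smooth test functions and curves -/

namespace RP2

/-- The point `[v]`, with the junk value `[(1, 0, 0)]` at `v = 0`. -/
def pt (v : Fin 3 → ℝ) : RP2 :=
  if h : v ≠ 0 then proj ⟨v, h⟩ else proj ⟨Pi.single 0 1, by simp⟩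

theorem pt_eq_proj {v : Fin 3 → ℝ} (h : v ≠ 0) : pt v = proj ⟨v, h⟩ := dif_pos h

theorem pt_rep (p : RP2) : pt p.rep = p := by
  rw [pt_eq_proj p.rep_nonzero]
  exact p.mk_rep

theorem exists_pt_eq (p : RP2) : ∃ v, v ≠ 0 ∧ pt v = p := ⟨p.rep, p.rep_nonzero, pt_rep p⟩

theorem pt_smul {t : ℝ} (ht : t ≠ 0) (v : Fin 3 → ℝ) : pt (t • v) = pt v := by
  by_cases hv : v = 0
  · simp [hv]
  · rw [pt_eq_proj hv, pt_eq_proj (smul_ne_zero ht hv), proj_eq_iff]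
    exact ⟨t, rfl⟩

theorem pt_neg (v : Fin 3 → ℝ) : pt (-v) = pt v := by
  simpa using pt_smul (t := -1) (by norm_num) v

theorem exists_smul_of_pt_eq {v w : Fin 3 → ℝ} (hv : v ≠ 0) (hw : w ≠ 0) (h : pt v = pt w) :
    ∃ t : ℝ, t ≠ 0 ∧ v = t • w := by
  rw [pt_eq_proj hv, pt_eq_proj hw, proj_eq_iff] at h
  obtain ⟨t, ht⟩ := h
  refine ⟨t, ?_, ht.symm⟩
  rintro rfl
  exact hv (by simpa using ht.symm)

theorem exists_rep_pt {v : Fin 3 → ℝ} (hv : v ≠ 0) : ∃ t : ℝ, t ≠ 0 ∧ (pt v).rep = t • v :=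
  exists_smul_of_pt_eq (pt v).rep_nonzero hv (pt_rep _)

theorem isOpen_iff_pt {U : Set RP2} : IsOpen U ↔ IsOpen {v : Fin 3 → ℝ | v ≠ 0 ∧ pt v ∈ U} := by
  rw [isOpen_coinduced]
  have h0 : IsOpen {v : Fin 3 → ℝ | v ≠ 0} := isOpen_ne
  have : {v : Fin 3 → ℝ | v ≠ 0 ∧ pt v ∈ U} = Subtype.val '' (proj ⁻¹' U) := by
    ext v
    constructor
    · rintro ⟨hv, h⟩
      exact ⟨⟨v, hv⟩, by rwa [pt_eq_proj hv] at h, rfl⟩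
    · rintro ⟨⟨v, hv⟩, h, rfl⟩
      exact ⟨hv, by rwa [pt_eq_proj hv]⟩
  rw [this]
  exact h0.isOpenEmbedding_subtypeVal.isOpen_iff_image_isOpen

theorem continuousOn_pt : ContinuousOn pt {v | v ≠ 0} := by
  rw [continuousOn_iff_continuous_domRestrict]
  have : Set.domRestrict {v : Fin 3 → ℝ | v ≠ 0} pt = proj := funext fun v => pt_eq_proj v.2
  rw [this]
  exact continuous_proj

/-- An even function on `ℝ³` whose sign at `v` depends only on `[v]`. -/
structure IsEvenForm (β : (Fin 3 → ℝ) → ℝ) : Prop where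
  cont : Continuous β
  smul : ∀ (t : ℝ) v, β (t • v) = t ^ 2 * β v

/-- The points where an even form is positive. -/
def posSet (β : (Fin 3 → ℝ) → ℝ) : Set RP2 := {p | 0 < β p.rep}

theorem IsEvenForm.mem_posSet {β : (Fin 3 → ℝ) → ℝ} (hβ : IsEvenForm β) {v : Fin 3 → ℝ}
    (hv : v ≠ 0) : pt v ∈ posSet β ↔ 0 < β v := by
  obtain ⟨t, ht, h⟩ := exists_rep_pt hv
  have : 0 < t ^ 2 := by positivity
  simp [posSet, h, hβ.smul, this]

theorem IsEvenForm.isOpen_posSet {β : (Fin 3 → ℝ) → ℝ} (hβ : IsEvenForm β) :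
    IsOpen (posSet β) := by
  rw [isOpen_iff_pt]
  have : {v : Fin 3 → ℝ | v ≠ 0 ∧ pt v ∈ posSet β} = {v | v ≠ 0} ∩ {v | 0 < β v} := by
    ext v
    exact and_congr_right fun hv => hβ.mem_posSet hv
  rw [this]
  exact isOpen_ne.inter (isOpen_lt continuous_const hβ.cont)

theorem pt_mem_projLine {a v : Fin 3 → ℝ} (hv : v ≠ 0) : pt v ∈ projLine a ↔ a ⬝ᵥ v = 0 := by
  obtain ⟨t, ht, h⟩ := exists_rep_pt hv
  simp [projLine, h, ht]

/-- The function `[v] ↦ (x ⬝ v) (y ⬝ v) / (v ⬝ v)`. -/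
def quad (x y : Fin 3 → ℝ) (p : RP2) : ℝ :=
  (x ⬝ᵥ p.rep) * (y ⬝ᵥ p.rep) / (p.rep ⬝ᵥ p.rep)

theorem quad_pt (x y : Fin 3 → ℝ) {v : Fin 3 → ℝ} (hv : v ≠ 0) :
    quad x y (pt v) = (x ⬝ᵥ v) * (y ⬝ᵥ v) / (v ⬝ᵥ v) := by
  obtain ⟨t, ht, h⟩ := exists_rep_pt hv
  have : v ⬝ᵥ v ≠ 0 := fun h => hv (dotProduct_self_eq_zero.1 h)
  simp only [quad, h, dotProduct_smul, smul_dotProduct, smul_eq_mul]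
  field_simp

theorem affineChart_mem_maximalAtlas (k : Fin 3) :
    affineChart k ∈ IsManifold.maximalAtlas (𝓡 2) ∞ RP2 :=
  IsManifold.subset_maximalAtlas ⟨k, rfl⟩

/-- Linear forms do not descend to the projective plane; these quotients of degree zero replace them
as smooth test functions. In an affine chart they are rational with a denominator that never
vanishes. -/
theorem contMDiff_quad (x y : Fin 3 → ℝ) : ContMDiff (𝓡 2) 𝓘(ℝ, ℝ) ∞ (quad x y) := by
  intro p
  obtain ⟨k, hk⟩ := exists_mem_patch p
  have h1 : ContMDiffOn (𝓡 2) (𝓡 2) ∞ (affineChart k) (patch k) :=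
    contMDiffOn_of_mem_maximalAtlas (affineChart_mem_maximalAtlas k)
  have hc : ∀ j, ContDiff ℝ ∞ fun w : EuclideanSpace ℝ (Fin 2) => insertOne k w j := by
    intro j
    rcases Fin.eq_self_or_eq_succAbove k j with rfl | ⟨l, rfl⟩
    · simpa [insertOne] using contDiff_const
    · simp only [insertOne, Fin.insertNth_apply_succAbove]
      fun_prop
  have h2 : ContDiff ℝ ∞ (fun w : EuclideanSpace ℝ (Fin 2) =>
      (x ⬝ᵥ insertOne k w) * (y ⬝ᵥ insertOne k w) / (insertOne k w ⬝ᵥ insertOne k w)) := by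
    have hd : ∀ z : Fin 3 → ℝ, ContDiff ℝ ∞ fun w : EuclideanSpace ℝ (Fin 2) =>
        z ⬝ᵥ insertOne k w := fun z =>
      ContDiff.sum fun j _ => contDiff_const.mul (hc j)
    refine ((hd x).mul (hd y)).div (ContDiff.sum fun j _ => (hc j).mul (hc j)) fun w h => ?_
    exact insertOne_ne_zero k w (dotProduct_self_eq_zero.1 h)
  have h3 := (h2.contMDiff.contMDiffOn (s := univ)).comp h1 (fun _ _ => mem_univ _)
  refine (h3.congr fun q hq => ?_).contMDiffAt ((isOpen_patch k).mem_nhds hk)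
  have hq' : (affineChart k).symm (affineChart k q) = q := (affineChart k).left_inv hq
  have : pt (insertOne k (affineChart k q)) = q := by
    rw [pt_eq_proj (insertOne_ne_zero k _)]
    exact hq'
  conv_lhs => rw [← this, quad_pt x y (insertOne_ne_zero k _)]
  rfl

theorem contMDiff_pt_comp {c : ℝ → Fin 3 → ℝ} (hc : ContDiff ℝ ∞ c) (h0 : ∀ t, c t ≠ 0) :
    ContMDiff 𝓘(ℝ, ℝ) (𝓡 2) ∞ fun t => pt (c t) := by
  intro t
  obtain ⟨k, hk⟩ : ∃ k, c t k ≠ 0 := by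
    by_contra! h
    exact h0 t (funext h)
  have h1 : ContMDiffOn (𝓡 2) (𝓡 2) ∞ (affineChart k).symm univ :=
    contMDiffOn_symm_of_mem_maximalAtlas (affineChart_mem_maximalAtlas k)
  have hj : ∀ j, ContDiff ℝ ∞ fun s => c s j := fun j => contDiff_pi.1 hc j
  have h2 : ContDiffOn ℝ ∞ (fun s => (WithLp.toLp 2 fun l : Fin 2 => c s (k.succAbove l) / c s k :
      EuclideanSpace ℝ (Fin 2))) {s | c s k ≠ 0} := by
    refine (PiLp.contDiff_toLp (𝕜 := ℝ) (p := 2)).comp_contDiffOn (contDiffOn_pi.2 fun l => ?_)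
    exact (hj _).contDiffOn.div (hj _).contDiffOn fun w hw => hw
  have h3 := h1.comp h2.contMDiffOn (fun _ _ => mem_univ _)
  have ho : IsOpen {s | c s k ≠ 0} := isOpen_ne_fun (hj k).continuous continuous_const
  refine (h3.congr fun s hs => ?_).contMDiffAt (ho.mem_nhds hk)
  have hs' : proj ⟨c s, h0 s⟩ ∈ patch k := (mem_patch_proj k _).2 hs
  rw [pt_eq_proj (h0 s)]
  exact ((affineChart k).left_inv hs').symm

/-- The bridge from tangent vectors to one-variable calculus: tangent vectors are examined below
through derivatives of functions along curves. -/
theorem hasDerivAt_comp_curve {h : RP2 → ℝ} {c : ℝ → RP2} (hh : ContMDiff (𝓡 2) 𝓘(ℝ, ℝ) ∞ h)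
    (hc : ContMDiff 𝓘(ℝ, ℝ) (𝓡 2) ∞ c) (t : ℝ) :
    HasDerivAt (fun s => h (c s)) (mfderiv (𝓡 2) 𝓘(ℝ, ℝ) h (c t) (velocity c t)) t := by
  have h1 := ((hh (c t)).mdifferentiableAt (by simp)).hasMFDerivAt
  have h2 := ((hc t).mdifferentiableAt (by simp)).hasMFDerivAt
  obtain ⟨A, hA⟩ : ∃ A : ℝ →L[ℝ] ℝ, A = (mfderiv (𝓡 2) 𝓘(ℝ, ℝ) h (c t)).comp
      (mfderiv 𝓘(ℝ, ℝ) (𝓡 2) c t) := ⟨_, rfl⟩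
  have h3 : HasFDerivAt (fun s => h (c s)) A t :=
    hA ▸ hasMFDerivAt_iff_hasFDerivAt.1 (h1.comp t h2)
  have h4 : A 1 = mfderiv (𝓡 2) 𝓘(ℝ, ℝ) h (c t) (velocity c t) := by
    rw [hA]
    rfl
  exact h4 ▸ h3.hasDerivAt

/-- `HasCorner` is a statement about all curves in certain directions, so extracting information
from it requires such a curve. A straight line in an affine chart serves, and it is defined for all
times because the chart has target `univ`. -/
theorem exists_curve_velocity (p : RP2) (u : TangentSpace (𝓡 2) p) :
    ∃ c : ℝ → RP2, ContMDiff 𝓘(ℝ, ℝ) (𝓡 2) ∞ c ∧ ∃ h : c 0 = p, h ▸ velocity c 0 = u := by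
  obtain ⟨k, hk⟩ := exists_mem_patch p
  set φ := affineChart k with hφ
  have hp : p ∈ φ.source := hk
  have h1 : ContMDiff (𝓡 2) (𝓡 2) ∞ φ.symm := by
    rw [← contMDiffOn_univ]
    exact contMDiffOn_symm_of_mem_maximalAtlas (affineChart_mem_maximalAtlas k)
  have h2 : MDifferentiableAt (𝓡 2) (𝓡 2) φ p :=
    ((contMDiffOn_of_mem_maximalAtlas (affineChart_mem_maximalAtlas k)).contMDiffAt
      (φ.open_source.mem_nhds hp)).mdifferentiableAt (n := ∞) (by simp)
  have h3 : MDifferentiableAt (𝓡 2) (𝓡 2) φ.symm (φ p) := (h1 _).mdifferentiableAt (by simp)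
  set w : EuclideanSpace ℝ (Fin 2) := mfderiv (𝓡 2) (𝓡 2) φ p u with hw
  have key : ∀ (q : RP2) (hq : φ.symm (φ p) = q) (u' : TangentSpace (𝓡 2) p),
      (mfderiv (𝓡 2) (𝓡 2) φ.symm (φ p) (mfderiv (𝓡 2) (𝓡 2) φ p u') :
        EuclideanSpace ℝ (Fin 2)) = u' := by
    intro q hq u'
    have := mfderiv_comp_apply p h3 h2 u'
    have h4 : mfderiv (𝓡 2) (𝓡 2) (φ.symm ∘ φ) p = ContinuousLinearMap.id ℝ _ := by
      rw [← mfderiv_id (I := 𝓡 2) (M := RP2)]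
      refine Filter.EventuallyEq.mfderiv_eq ?_
      filter_upwards [φ.open_source.mem_nhds hp] with q hq using φ.left_inv hq
    refine this.symm.trans ?_
    have h5 := congrArg (fun A : EuclideanSpace ℝ (Fin 2) →L[ℝ] EuclideanSpace ℝ (Fin 2) =>
      A u') h4
    exact h5
  let ℓ : ℝ → EuclideanSpace ℝ (Fin 2) := fun t => φ p + t • w
  have hℓ : ContDiff ℝ ∞ ℓ := by fun_prop
  have h0 : ℓ 0 = φ p := by simp [ℓ]
  have hc0 : φ.symm (ℓ 0) = p := by rw [h0, φ.left_inv hp]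
  have hd : (mfderiv 𝓘(ℝ, ℝ) (𝓡 2) ℓ 0 (1 : ℝ) : EuclideanSpace ℝ (Fin 2)) = w := by
    rw [mfderiv_eq_fderiv]
    have : HasDerivAt ℓ w 0 := by
      simpa [ℓ] using ((hasDerivAt_id (0 : ℝ)).smul_const w).const_add (φ p)
    rw [this.hasFDerivAt.fderiv]
    exact one_smul ℝ w
  refine ⟨φ.symm ∘ ℓ, h1.comp hℓ.contMDiff, hc0, ?_⟩
  have hcast : ∀ (q : RP2) (hq : q = p) (v : TangentSpace (𝓡 2) q),
      ((hq ▸ v : TangentSpace (𝓡 2) p) : EuclideanSpace ℝ (Fin 2)) = v := by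
    rintro q rfl v
    rfl
  refine (hcast _ hc0 _).trans ?_
  have h6 : velocity (φ.symm ∘ ℓ) 0 = mfderiv (𝓡 2) (𝓡 2) φ.symm (ℓ 0)
      (mfderiv 𝓘(ℝ, ℝ) (𝓡 2) ℓ 0 (1 : ℝ)) :=
    mfderiv_comp_apply 0 ((h1 _).mdifferentiableAt (by simp))
      ((hℓ.contMDiff (0 : ℝ)).mdifferentiableAt (by simp)) _
  have h7 : ∀ y, y = φ p → ∀ z : EuclideanSpace ℝ (Fin 2), z = w →
      (mfderiv (𝓡 2) (𝓡 2) φ.symm y z : EuclideanSpace ℝ (Fin 2)) = u := by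
    rintro y rfl z rfl
    exact key _ rfl u
  exact h6.trans (h7 _ h0 _ hd)


/-! ### The double cover by the sphere and the lift of an isotopy -/

/-- The unit sphere of `ℝ³` for the supremum norm. -/
abbrev Sph : Type := Metric.sphere (0 : Fin 3 → ℝ) 1

theorem Sph.ne_zero (v : Sph) : v.1 ≠ 0 := by
  intro h
  have := norm_eq_of_mem_sphere v
  simp [h] at this

/-- The radial projection to the unit sphere (with a junk value at `0`). -/
def radial (v : Fin 3 → ℝ) : Sph :=
  if h : v ≠ 0 then ⟨‖v‖⁻¹ • v, by simp [norm_smul, h]⟩ else ⟨fun _ => 1, by simp⟩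

theorem radial_coe {v : Fin 3 → ℝ} (h : v ≠ 0) : (radial v : Fin 3 → ℝ) = ‖v‖⁻¹ • v := by
  simp [radial, h]

theorem radial_sph (v : Sph) : radial v.1 = v := by
  ext1
  rw [radial_coe v.ne_zero, norm_eq_of_mem_sphere v]
  simp

theorem norm_smul_radial (v : Fin 3 → ℝ) : ‖v‖ • (radial v : Fin 3 → ℝ) = v := by
  by_cases h : v = 0
  · simp [h]
  · rw [radial_coe h, smul_smul, mul_inv_cancel₀ (norm_ne_zero_iff.2 h), one_smul]

theorem radial_smul_pos {t : ℝ} (ht : 0 < t) (v : Fin 3 → ℝ) : radial (t • v) = radial v := by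
  by_cases h : v = 0
  · simp [h]
  · ext1
    rw [radial_coe h, radial_coe (smul_ne_zero ht.ne' h), norm_smul, smul_smul, Real.norm_eq_abs,
      abs_of_pos ht]
    congr 1
    field_simp

theorem radial_neg {v : Fin 3 → ℝ} (h : v ≠ 0) : radial (-v) = -radial v := by
  ext1
  rw [coe_neg_sphere, radial_coe h, radial_coe (neg_ne_zero.2 h), norm_neg, smul_neg]

theorem continuousOn_radial : ContinuousOn radial {v | v ≠ 0} := by
  rw [Topology.IsInducing.subtypeVal.continuousOn_iff]
  have : ContinuousOn (fun v : Fin 3 → ℝ => ‖v‖⁻¹ • v) {v | v ≠ 0} :=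
    (continuousOn_id.norm.inv₀ fun v hv => norm_ne_zero_iff.2 hv).smul continuousOn_id
  exact this.congr fun v hv => radial_coe hv

/-- The double cover of the projective plane by the sphere. -/
def sphProj (v : Sph) : RP2 := pt v.1

theorem sphProj_radial {v : Fin 3 → ℝ} (h : v ≠ 0) : sphProj (radial v) = pt v := by
  rw [sphProj, radial_coe h, pt_smul (inv_ne_zero (norm_ne_zero_iff.2 h))]

theorem continuous_sphProj : Continuous sphProj :=
  continuousOn_pt.comp_continuous continuous_subtype_val fun v => v.ne_zero

theorem isQuotientMap_sphProj : IsQuotientMap sphProj := by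
  have h1 : Continuous fun v : {v : Fin 3 → ℝ // v ≠ 0} => radial v.1 :=
    continuousOn_radial.comp_continuous continuous_subtype_val fun v => v.2
  refine IsQuotientMap.of_comp h1 continuous_sphProj ?_
  have h2 : sphProj ∘ (fun v : {v : Fin 3 → ℝ // v ≠ 0} => radial v.1) = proj := by
    funext v
    exact (sphProj_radial v.2).trans (pt_eq_proj v.2)
  rw [h2]
  exact ⟨⟨rfl⟩, exists_proj_eq⟩

theorem sphProj_eq_iff (v w : Sph) : sphProj v = sphProj w ↔ v = w ∨ v = -w := by
  constructor
  · intro h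
    obtain ⟨t, -, ht⟩ := exists_smul_of_pt_eq v.ne_zero w.ne_zero h
    have h1 : |t| = 1 := by
      have := congrArg norm ht
      rwa [norm_smul, norm_eq_of_mem_sphere v, norm_eq_of_mem_sphere w, mul_one,
        Real.norm_eq_abs, eq_comm] at this
    rcases eq_or_eq_neg_of_abs_eq h1 with rfl | rfl
    · exact Or.inl (Subtype.ext (by simpa using ht))
    · exact Or.inr (Subtype.ext (by simpa using ht))
  · rintro (rfl | rfl)
    · rfl
    · simp [sphProj, pt_neg]

/-- The antipodal action. -/
@[reducible] def antipodalAction : MulAction ℤˣ Sph where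
  smul u v := if u = 1 then v else -v
  one_smul v := if_pos rfl
  mul_smul a b v := by
    change (if a * b = 1 then v else -v) = if a = 1 then (if b = 1 then v else -v)
      else -(if b = 1 then v else -v)
    rcases Int.units_eq_one_or a with rfl | rfl <;> rcases Int.units_eq_one_or b with rfl | rfl <;>
      simp

theorem isCoveringMap_sphProj : IsCoveringMap sphProj := by
  let := antipodalAction
  have hs : ∀ v : Sph, (-1 : ℤˣ) • v = -v := fun v => if_neg (by decide)
  have : IsQuotientCoveringMap sphProj ℤˣ :=
    { isQuotientMap_sphProj with
      continuous_const_smul := by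
        intro u
        rcases Int.units_eq_one_or u with rfl | rfl
        · simp only [one_smul]
          exact continuous_id
        · simp only [hs]
          exact continuous_neg
      apply_eq_iff_mem_orbit := by
        intro v w
        rw [sphProj_eq_iff, MulAction.mem_orbit_iff]
        constructor
        · rintro (rfl | rfl)
          · exact ⟨1, one_smul _ _⟩
          · exact ⟨-1, hs w⟩
        · rintro ⟨u, rfl⟩
          rcases Int.units_eq_one_or u with rfl | rfl
          · exact Or.inl (one_smul _ _)
          · exact Or.inr (hs w)
      disjoint := by
        intro v
        -- Antipodal points of the unit sphere are at distance 2, so an open ball of radius 1 is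
        -- disjoint from its antipodal image.
        refine ⟨Metric.ball v 1, Metric.ball_mem_nhds v one_pos, fun u hu => ?_⟩
        rcases Int.units_eq_one_or u with rfl | rfl
        · rfl
        · exfalso
          obtain ⟨_, ⟨w, hw, rfl⟩, hw'⟩ := hu
          simp only [hs] at hw'
          have h1 : dist w (-w) < 2 := by
            have := dist_triangle_right w (-w) v
            rw [Metric.mem_ball] at hw hw'
            linarith
          have h2 : dist w (-w) = 2 := by
            rw [Subtype.dist_eq, coe_neg_sphere, dist_eq_norm, sub_neg_eq_add, ← two_smul ℝ,
              norm_smul, norm_eq_of_mem_sphere w]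
            norm_num
          linarith }
  exact this.isCoveringMap

/-- The cone over a map of the sphere. -/
def cone (G : Sph → Sph) (v : Fin 3 → ℝ) : Fin 3 → ℝ := ‖v‖ • (G (radial v) : Fin 3 → ℝ)

theorem norm_cone (G : Sph → Sph) (v : Fin 3 → ℝ) : ‖cone G v‖ = ‖v‖ := by
  simp [cone, norm_smul, norm_eq_of_mem_sphere (G (radial v))]

/-- At the origin, where `radial` has a junk value, continuity comes from the preservation of the
norm. -/
theorem continuous_cone {G : Sph → Sph} (hG : Continuous G) : Continuous (cone G) := by
  rw [continuous_iff_continuousAt]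
  intro v
  by_cases hv : v = 0
  · subst hv
    have h0 : cone G 0 = 0 := by simp [cone]
    rw [ContinuousAt, h0, tendsto_zero_iff_norm_tendsto_zero]
    simp only [norm_cone]
    simpa using (continuous_norm (E := Fin 3 → ℝ)).tendsto 0
  · have h1 : ContinuousAt radial v := continuousOn_radial.continuousAt (isOpen_ne.mem_nhds hv)
    exact continuousAt_id.norm.smul
      (continuous_subtype_val.continuousAt.comp (hG.continuousAt.comp h1))

theorem radial_cone (G : Sph → Sph) {v : Fin 3 → ℝ} (hv : v ≠ 0) :
    radial (cone G v) = G (radial v) := by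
  rw [cone, radial_smul_pos (norm_pos_iff.2 hv), radial_sph]

theorem cone_cone {G G' : Sph → Sph} (h : ∀ v, G' (G v) = v) (v : Fin 3 → ℝ) :
    cone G' (cone G v) = v := by
  by_cases hv : v = 0
  · simp [hv, cone]
  · rw [cone, radial_cone G hv, h, norm_cone, norm_smul_radial]

theorem cone_smul {G : Sph → Sph} (hG : ∀ v, G (-v) = -G v) (t : ℝ) (v : Fin 3 → ℝ) :
    cone G (t • v) = t • cone G v := by
  by_cases hv : v = 0
  · simp [hv, cone]
  rcases lt_trichotomy t 0 with ht | rfl | ht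
  · have : t • v = -((-t) • v) := by simp
    rw [cone, cone, this, radial_neg (smul_ne_zero (by linarith) hv),
      radial_smul_pos (by linarith), hG, coe_neg_sphere, norm_neg, norm_smul, Real.norm_eq_abs,
      abs_neg, abs_of_neg ht, smul_smul, smul_neg, neg_mul, neg_smul, neg_neg]
  · simp [cone]
  · rw [cone, cone, radial_smul_pos ht, norm_smul, Real.norm_eq_abs, abs_of_pos ht, smul_smul]

/-- An isotopy of the projective plane ends with a map that lifts to a homogeneous homeomorphism
of `ℝ³`. -/
theorem exists_homogeneous_lift (Φ : ℝ → RP2 ≃ RP2)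
    (hΦ : ContinuousOn (fun q : ℝ × RP2 => Φ q.1 q.2) (Icc 0 1 ×ˢ univ)) (h0 : ∀ p, Φ 0 p = p) :
    ∃ g : (Fin 3 → ℝ) ≃ₜ (Fin 3 → ℝ), (∀ (t : ℝ) v, g (t • v) = t • g v) ∧
      ∀ v, v ≠ 0 → pt (g v) = Φ 1 (pt v) := by
  let H : C(unitInterval × Sph, RP2) :=
    ⟨fun q => Φ q.1 (sphProj q.2), hΦ.comp_continuous
      (f := fun q : unitInterval × Sph => ((q.1 : ℝ), sphProj q.2))
      ((continuous_subtype_val.comp continuous_fst).prodMk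
        (continuous_sphProj.comp continuous_snd)) fun q => ⟨q.1.2, mem_univ _⟩⟩
  have hH0 : ∀ v, H (0, v) = sphProj (ContinuousMap.id Sph v) := fun v => h0 _
  -- The isotopy starts at the identity, so its composite with the cover lifts to a homotopy of the
  -- sphere that starts at the identity.
  let K := isCoveringMap_sphProj.liftHomotopy H (ContinuousMap.id Sph) hH0
  have hK : ∀ t v, sphProj (K (t, v)) = Φ t (sphProj v) := fun t v =>
    congrFun (isCoveringMap_sphProj.liftHomotopy_lifts H (ContinuousMap.id Sph) hH0) (t, v)
  have hK0 : ∀ v, K (0, v) = v :=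
    isCoveringMap_sphProj.liftHomotopy_zero H (ContinuousMap.id Sph) hH0
  -- Conjugating the lift by the antipodal map gives another lift with the same start, and lifts are
  -- unique.
  have hodd : ∀ t v, K (t, -v) = -K (t, v) := by
    have : (fun q : unitInterval × Sph => -K (q.1, -q.2)) = K := by
      refine (isCoveringMap_sphProj.eq_liftHomotopy_iff hH0 _).2 ⟨fun v => ?_, ?_, fun v => ?_⟩
      · exact (K.continuous.comp (by fun_prop : Continuous fun t : unitInterval => (t, -v))).neg
      · funext ⟨t, v⟩
        have h1 : ∀ w : Sph, sphProj (-w) = sphProj w := fun w =>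
          (sphProj_eq_iff _ _).2 (Or.inr rfl)
        simp only [Function.comp, h1, hK]
        rfl
      · simp [hK0]
    intro t v
    have := congrFun this (t, v)
    simp only at this
    rw [← this, neg_neg]
  let G : Sph → Sph := fun v => K (1, v)
  have hGc : Continuous G := K.continuous.comp (by fun_prop)
  have hGodd : ∀ v, G (-v) = -G v := hodd 1
  have hGp : ∀ v, sphProj (G v) = Φ 1 (sphProj v) := fun v => by simpa using hK 1 v
  -- Bijectivity downstairs gives it upstairs up to sign; oddness of `G` settles the sign.
  have hbij : Function.Bijective G := by
    constructor
    · intro v w hvw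
      have h1 : sphProj v = sphProj w := (Φ 1).injective (by rw [← hGp, ← hGp, hvw])
      rcases (sphProj_eq_iff _ _).1 h1 with h | h
      · exact h
      · rw [h, hGodd] at hvw
        exact absurd hvw.symm (by
          intro h2
          have h3 : ((G w).1 : Fin 3 → ℝ) = -(G w).1 := congrArg Subtype.val h2
          exact (G w).ne_zero (self_eq_neg.1 h3))
    · intro w
      obtain ⟨v, hv⟩ := isQuotientMap_sphProj.surjective ((Φ 1).symm (sphProj w))
      have h1 : sphProj (G v) = sphProj w := by rw [hGp, hv, Equiv.apply_symm_apply]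
      rcases (sphProj_eq_iff _ _).1 h1 with h | h
      · exact ⟨v, h⟩
      · exact ⟨-v, by rw [hGodd, h, neg_neg]⟩
  have hsymm : Continuous (Equiv.ofBijective G hbij).symm :=
    hGc.continuous_symm_of_equiv_compact_to_t2 (f := Equiv.ofBijective G hbij)
  refine ⟨{ toFun := cone G
            invFun := cone (Equiv.ofBijective G hbij).symm
            left_inv := cone_cone (Equiv.ofBijective G hbij).left_inv
            right_inv := cone_cone (Equiv.ofBijective G hbij).right_inv
            continuous_toFun := continuous_cone hGc
            continuous_invFun := continuous_cone hsymm }, cone_smul hGodd, fun v hv => ?_⟩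
  change pt (cone G v) = _
  have hne : cone G v ≠ 0 := by
    rw [← norm_ne_zero_iff, norm_cone]
    exact norm_ne_zero_iff.2 hv
  rw [← sphProj_radial hne, radial_cone G hv, hGp, sphProj_radial hv]


/-! ### Straightened pseudolines: equations, parametrizations, tangent lines -/

/-- The velocity of a curve, as an element of the model plane. -/
def vel (c : ℝ → RP2) (t : ℝ) : EuclideanSpace ℝ (Fin 2) := velocity c t

/-- The differential of a function on the projective plane, as a functional on the model plane. -/
def differential (h : RP2 → ℝ) (p : RP2) : EuclideanSpace ℝ (Fin 2) →L[ℝ] ℝ :=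
  mfderiv (𝓡 2) 𝓘(ℝ, ℝ) h p

theorem hasDerivAt_comp {h : RP2 → ℝ} {c : ℝ → RP2} (hh : ContMDiff (𝓡 2) 𝓘(ℝ, ℝ) ∞ h)
    (hc : ContMDiff 𝓘(ℝ, ℝ) (𝓡 2) ∞ c) (t : ℝ) :
    HasDerivAt (fun s => h (c s)) (differential h (c t) (vel c t)) t :=
  hasDerivAt_comp_curve hh hc t

theorem vel_comp_mul {c : ℝ → RP2} (hc : ContMDiff 𝓘(ℝ, ℝ) (𝓡 2) ∞ c) (a t : ℝ) :
    vel (fun s => c (a * s)) t = a • vel c (a * t) := by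
  have hl : ContDiff ℝ ∞ fun s : ℝ => a * s := by fun_prop
  have h1 : velocity (c ∘ fun s => a * s) t = mfderiv 𝓘(ℝ, ℝ) (𝓡 2) c (a * t)
      (mfderiv 𝓘(ℝ, ℝ) 𝓘(ℝ, ℝ) (fun s => a * s) t (1 : ℝ)) :=
    mfderiv_comp_apply t ((hc _).mdifferentiableAt (by simp))
      ((hl.contMDiff t).mdifferentiableAt (by simp)) _
  have h2 : (mfderiv 𝓘(ℝ, ℝ) 𝓘(ℝ, ℝ) (fun s : ℝ => a * s) t (1 : ℝ) : ℝ) = a • (1 : ℝ) := by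
    rw [mfderiv_eq_fderiv]
    have : HasDerivAt (fun s : ℝ => a * s) a t := by simpa using (hasDerivAt_id t).const_mul a
    rw [this.hasFDerivAt.fderiv]
    exact (one_smul ℝ a).trans (by simp)
  have h3 : ∀ z : ℝ, z = a • (1 : ℝ) →
      (mfderiv 𝓘(ℝ, ℝ) (𝓡 2) c (a * t) z : EuclideanSpace ℝ (Fin 2)) = a • vel c (a * t) := by
    rintro z rfl
    exact ContinuousLinearMap.map_smul (mfderiv 𝓘(ℝ, ℝ) (𝓡 2) c (a * t)) a (1 : ℝ)
  exact h1.trans (h3 _ h2)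

theorem exists_smul_of_mem_ker (φ : EuclideanSpace ℝ (Fin 2) →L[ℝ] ℝ) (hφ : φ ≠ 0)
    {u w : EuclideanSpace ℝ (Fin 2)} (hu : φ u = 0) (hu0 : u ≠ 0) (hw : φ w = 0) :
    ∃ r : ℝ, w = r • u := by
  have h1 : Module.finrank ℝ (LinearMap.range φ.toLinearMap) = 1 := by
    have : LinearMap.range φ.toLinearMap = ⊤ :=
      LinearMap.range_eq_top.2 (LinearMap.surjective (fun h => hφ (by ext1 v; exact congrArg (· v) h)))
    rw [this, finrank_top, Module.finrank_self]
  have h2 := LinearMap.finrank_range_add_finrank_ker φ.toLinearMap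
  have h3 : Module.finrank ℝ (LinearMap.ker φ.toLinearMap) = 1 := by
    rw [h1, finrank_euclideanSpace, Fintype.card_fin] at h2
    omega
  have hne : (⟨u, hu⟩ : LinearMap.ker φ.toLinearMap) ≠ 0 := fun h => hu0 (congrArg Subtype.val h)
  obtain ⟨r, hr⟩ := (finrank_eq_one_iff_of_nonzero' _ hne).1 h3 ⟨w, hw⟩
  exact ⟨r, (congrArg Subtype.val hr).symm⟩

theorem exists_perp {a : Fin 3 → ℝ} : ∃ b : Fin 3 → ℝ, b ≠ 0 ∧ a ⬝ᵥ b = 0 := by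
  by_cases h : a 0 = 0
  · refine ⟨![1, 0, 0], fun h => by simpa using congrFun h 0, ?_⟩
    simp [dotProduct, Fin.sum_univ_three, h]
  · refine ⟨![-a 1, a 0, 0], fun h' => h (by simpa using congrFun h' 1), ?_⟩
    simp [dotProduct, Fin.sum_univ_three]
    ring

theorem exists_normalize {a : Fin 3 → ℝ} (ha : a ≠ 0) :
    ∃ s : ℝ, s ≠ 0 ∧ (s • a) ⬝ᵥ (s • a) = 1 := by
  have h0 : 0 < a ⬝ᵥ a :=
    lt_of_le_of_ne (Finset.sum_nonneg fun i _ => mul_self_nonneg _)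
      fun h => ha (dotProduct_self_eq_zero.1 h.symm)
  refine ⟨(Real.sqrt (a ⬝ᵥ a))⁻¹, by positivity, ?_⟩
  rw [smul_dotProduct, dotProduct_smul, smul_eq_mul, smul_eq_mul, ← mul_assoc, ← mul_inv,
    Real.mul_self_sqrt h0.le, inv_mul_cancel₀ h0.ne']

theorem exists_frame {a : Fin 3 → ℝ} (ha : a ≠ 0) : ∃ e : Fin 3 → Fin 3 → ℝ,
    (∀ i j, e i ⬝ᵥ e j = if i = j then 1 else 0) ∧ projLine (e 2) = projLine a := by
  obtain ⟨b, hb, hab⟩ := exists_perp (a := a)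
  obtain ⟨s, hs, hs1⟩ := exists_normalize ha
  obtain ⟨t, ht, ht1⟩ := exists_normalize hb
  have h20 : (s • a) ⬝ᵥ (t • b) = 0 := by simp [hab]
  have h02 : (t • b) ⬝ᵥ (s • a) = 0 := by rw [dotProduct_comm, h20]
  have h11 : crossProduct (s • a) (t • b) ⬝ᵥ crossProduct (s • a) (t • b) = 1 := by
    rw [cross_dot_cross, hs1, ht1, h20, h02]
    ring
  have hx := dot_self_cross (s • a) (t • b)
  have hy := dot_cross_self (s • a) (t • b)
  refine ⟨![t • b, crossProduct (s • a) (t • b), s • a], ?_, ?_⟩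
  · intro i j
    fin_cases i <;> fin_cases j
    · exact ht1
    · exact hy
    · exact h02
    · exact (dotProduct_comm _ _).trans hy
    · exact h11
    · exact (dotProduct_comm _ _).trans hx
    · exact h20
    · exact hx
    · exact hs1
  · ext p
    simp [projLine, hs]

/-- A diffeomorphism of the projective plane that carries a projective line to `L`, together with
a lift of it to a homogeneous homeomorphism of `ℝ³` and an orthonormal frame whose last vector is
normal to the projective line. -/
structure Straightening (L : Set RP2) where
  F : Diffeomorph (𝓡 2) (𝓡 2) RP2 RP2 ∞
  g : (Fin 3 → ℝ) ≃ₜ (Fin 3 → ℝ)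
  g_smul : ∀ (t : ℝ) v, g (t • v) = t • g v
  pt_g : ∀ v, v ≠ 0 → pt (g v) = F (pt v)
  e : Fin 3 → Fin 3 → ℝ
  dot_e : ∀ i j, e i ⬝ᵥ e j = if i = j then 1 else 0
  image_eq : F '' projLine (e 2) = L

theorem _root_.IsPseudoline.nonempty_straightening {L : Set RP2} (h : IsPseudoline L) :
    Nonempty (Straightening L) := by
  obtain ⟨Φ, a, ha, hsm, h0, hL⟩ := h
  obtain ⟨e, he, hea⟩ := exists_frame ha
  obtain ⟨g, hg, hgp⟩ := exists_homogeneous_lift (fun t => (Φ t).toEquiv) hsm.continuousOn h0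
  exact ⟨⟨Φ 1, g, hg, hgp, e, he, by rw [hea, hL]⟩⟩

namespace Straightening

variable {L : Set RP2} (S : Straightening L)

theorem g_zero : S.g 0 = 0 := by simpa using S.g_smul 0 0

theorem g_ne_zero {v : Fin 3 → ℝ} (hv : v ≠ 0) : S.g v ≠ 0 := fun h =>
  hv (S.g.injective (h.trans S.g_zero.symm))

theorem g_symm_smul (t : ℝ) (v : Fin 3 → ℝ) : S.g.symm (t • v) = t • S.g.symm v := by
  rw [Homeomorph.symm_apply_eq, S.g_smul, Homeomorph.apply_symm_apply]

theorem g_symm_ne_zero {v : Fin 3 → ℝ} (hv : v ≠ 0) : S.g.symm v ≠ 0 := fun h => by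
  rw [Homeomorph.symm_apply_eq, S.g_zero] at h
  exact hv h

theorem F_symm_pt {v : Fin 3 → ℝ} (hv : v ≠ 0) : S.F.symm (pt v) = pt (S.g.symm v) := by
  have := S.pt_g _ (S.g_symm_ne_zero hv)
  rw [Homeomorph.apply_symm_apply] at this
  rw [this, Diffeomorph.symm_apply_apply]

theorem expand (v : Fin 3 → ℝ) :
    v = (S.e 0 ⬝ᵥ v) • S.e 0 + (S.e 1 ⬝ᵥ v) • S.e 1 + (S.e 2 ⬝ᵥ v) • S.e 2 := by
  let M : Matrix (Fin 3) (Fin 3) ℝ := Matrix.of S.e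
  have h1 : M * M.transpose = 1 := by
    ext i j
    exact (S.dot_e i j).trans (Matrix.one_apply (α := ℝ)).symm
  have h2 := mul_eq_one_comm.1 h1
  have h3 : M.transpose.mulVec (M.mulVec v) = v := by
    rw [Matrix.mulVec_mulVec, h2, Matrix.one_mulVec]
  conv_lhs => rw [← h3]
  funext j
  simp only [Matrix.mulVec, dotProduct, Fin.sum_univ_three, Matrix.transpose_apply, M,
    Matrix.of_apply, Pi.add_apply, Pi.smul_apply, smul_eq_mul]
  ring

/-- The defining function of the cone over `L`. -/
def f (v : Fin 3 → ℝ) : ℝ := S.e 2 ⬝ᵥ S.g.symm v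

theorem f_smul (t : ℝ) (v : Fin 3 → ℝ) : S.f (t • v) = t * S.f v := by
  simp [f, g_symm_smul]

theorem f_neg (v : Fin 3 → ℝ) : S.f (-v) = -S.f v := by
  simpa using S.f_smul (-1) v

theorem continuous_f : Continuous S.f :=
  continuous_const.dotProduct S.g.symm.continuous

theorem pt_mem_iff {v : Fin 3 → ℝ} (hv : v ≠ 0) : pt v ∈ L ↔ S.f v = 0 := by
  have h1 : pt v ∈ L ↔ S.F.symm (pt v) ∈ projLine (S.e 2) := by
    conv_lhs => rw [← S.image_eq]
    constructor
    · rintro ⟨q, hq, h⟩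
      rwa [← h, Diffeomorph.symm_apply_apply]
    · exact fun h => ⟨_, h, Diffeomorph.apply_symm_apply _ _⟩
  rw [h1, S.F_symm_pt hv, pt_mem_projLine (S.g_symm_ne_zero hv), f]

/-- The unit circle of the plane orthogonal to the last vector of the frame. -/
def circle (θ : ℝ) : Fin 3 → ℝ := Real.cos θ • S.e 0 + Real.sin θ • S.e 1

theorem dot_circle_zero (θ : ℝ) : S.e 0 ⬝ᵥ S.circle θ = Real.cos θ := by
  simp [circle, S.dot_e]

theorem dot_circle_one (θ : ℝ) : S.e 1 ⬝ᵥ S.circle θ = Real.sin θ := by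
  simp [circle, S.dot_e]

theorem dot_circle_two (θ : ℝ) : S.e 2 ⬝ᵥ S.circle θ = 0 := by
  simp [circle, S.dot_e]

theorem circle_dot_self (θ : ℝ) : S.circle θ ⬝ᵥ S.circle θ = 1 := by
  conv_lhs => enter [1]; rw [circle]
  rw [add_dotProduct, smul_dotProduct, smul_dotProduct, S.dot_circle_zero, S.dot_circle_one,
    smul_eq_mul, smul_eq_mul]
  nlinarith [Real.sin_sq_add_cos_sq θ]

theorem circle_ne_zero (θ : ℝ) : S.circle θ ≠ 0 := fun h => by
  simpa [h] using S.circle_dot_self θ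

theorem circle_add_pi (θ : ℝ) : S.circle (θ + Real.pi) = -S.circle θ := by
  simp only [circle, Real.cos_add_pi, Real.sin_add_pi, neg_smul]
  abel

theorem contDiff_circle : ContDiff ℝ ∞ S.circle :=
  (Real.contDiff_cos.smul contDiff_const).add (Real.contDiff_sin.smul contDiff_const)

/-- The closed curve on the cone over `L` that covers `L` twice. -/
def lift (θ : ℝ) : Fin 3 → ℝ := S.g (S.circle θ)

theorem lift_ne_zero (θ : ℝ) : S.lift θ ≠ 0 := S.g_ne_zero (S.circle_ne_zero θ)

theorem lift_add_pi (θ : ℝ) : S.lift (θ + Real.pi) = -S.lift θ := by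
  have := S.g_smul (-1) (S.circle θ)
  simpa [lift, circle_add_pi] using this

theorem continuous_lift : Continuous S.lift := S.g.continuous.comp S.contDiff_circle.continuous

theorem f_lift (θ : ℝ) : S.f (S.lift θ) = 0 := by
  simp [f, lift, S.dot_circle_two]

theorem exists_lift_of_f_eq_zero {v : Fin 3 → ℝ} (hv : v ≠ 0) (h : S.f v = 0) :
    ∃ (r θ : ℝ), 0 < r ∧ v = r • S.lift θ := by
  set w := S.g.symm v with hw
  have hw0 : w ≠ 0 := S.g_symm_ne_zero hv
  have h1 := S.expand w
  rw [show S.e 2 ⬝ᵥ w = 0 from h, zero_smul, add_zero] at h1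
  -- Polar coordinates in the plane of the first two frame vectors, taken from the modulus and
  -- argument of a complex number.
  let z : ℂ := ⟨S.e 0 ⬝ᵥ w, S.e 1 ⬝ᵥ w⟩
  have hz : z ≠ 0 := by
    intro hz
    have h2 := congrArg Complex.re hz
    have h3 := congrArg Complex.im hz
    simp only [z, Complex.zero_re, Complex.zero_im] at h2 h3
    rw [h2, h3] at h1
    exact hw0 (by simpa using h1)
  refine ⟨‖z‖, z.arg, norm_pos_iff.2 hz, ?_⟩
  have h4 : w = ‖z‖ • S.circle z.arg := by
    rw [circle, smul_add, smul_smul, smul_smul, Complex.norm_mul_cos_arg, Complex.norm_mul_sin_arg]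
    exact h1
  rw [lift, ← S.g_smul, ← h4, hw, Homeomorph.apply_symm_apply]

/-- The standard parametrization of `L`. -/
def curve (θ : ℝ) : RP2 := pt (S.lift θ)

theorem curve_eq (θ : ℝ) : S.curve θ = S.F (pt (S.circle θ)) := S.pt_g _ (S.circle_ne_zero θ)

theorem curve_mem (θ : ℝ) : S.curve θ ∈ L := (S.pt_mem_iff (S.lift_ne_zero θ)).2 (S.f_lift θ)

theorem contMDiff_curve : ContMDiff 𝓘(ℝ, ℝ) (𝓡 2) ∞ S.curve := by
  have h : S.curve = S.F ∘ fun θ => pt (S.circle θ) := funext S.curve_eq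
  rw [h]
  exact S.F.contMDiff_toFun.comp (contMDiff_pt_comp S.contDiff_circle S.circle_ne_zero)

theorem exists_curve_eq {p : RP2} (hp : p ∈ L) : ∃ θ, S.curve θ = p := by
  obtain ⟨v, hv, rfl⟩ := exists_pt_eq p
  obtain ⟨r, θ, hr, rfl⟩ := S.exists_lift_of_f_eq_zero hv ((S.pt_mem_iff hv).1 hp)
  exact ⟨θ, (pt_smul hr.ne' _).symm⟩

theorem range_curve : range S.curve = L :=
  Subset.antisymm (range_subset_iff.2 S.curve_mem) fun _ hp => S.exists_curve_eq hp

/-- The function `[v] ↦ (x ⬝ v) (y ⬝ v) / (v ⬝ v)` in the coordinates that straighten `L`. -/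
def quad (x y : Fin 3 → ℝ) (p : RP2) : ℝ := RP2.quad x y (S.F.symm p)

theorem contMDiff_quad (x y : Fin 3 → ℝ) : ContMDiff (𝓡 2) 𝓘(ℝ, ℝ) ∞ (S.quad x y) :=
  (RP2.contMDiff_quad x y).comp S.F.contMDiff_invFun

theorem quad_pt (x y : Fin 3 → ℝ) {v : Fin 3 → ℝ} (hv : v ≠ 0) :
    S.quad x y (pt v) = (x ⬝ᵥ S.g.symm v) * (y ⬝ᵥ S.g.symm v) /
      (S.g.symm v ⬝ᵥ S.g.symm v) := by
  rw [quad, S.F_symm_pt hv, RP2.quad_pt x y (S.g_symm_ne_zero hv)]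

theorem quad_curve (x y : Fin 3 → ℝ) (θ : ℝ) :
    S.quad x y (S.curve θ) = (x ⬝ᵥ S.circle θ) * (y ⬝ᵥ S.circle θ) := by
  rw [curve, S.quad_pt _ _ (S.lift_ne_zero θ), lift, Homeomorph.symm_apply_apply,
    S.circle_dot_self, div_one]

theorem quad_eq_zero (x : Fin 3 → ℝ) {p : RP2} (hp : p ∈ L) : S.quad x (S.e 2) p = 0 := by
  obtain ⟨θ, rfl⟩ := S.exists_curve_eq hp
  rw [S.quad_curve, S.dot_circle_two, mul_zero]

/-- This makes the function a local equation of `L` at that point. Along the straightened curve `x +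
s • S.e 2`, normal to the line, it equals |x|² s / (|x|² + s²), whose derivative at 0 is 1. -/
theorem differential_quad_ne_zero {x : Fin 3 → ℝ} (hx : x ≠ 0) (hx2 : S.e 2 ⬝ᵥ x = 0) :
    differential (S.quad x (S.e 2)) (pt (S.g x)) ≠ 0 := by
  have hxx : x ⬝ᵥ x ≠ 0 := fun h => hx (dotProduct_self_eq_zero.1 h)
  have h2x : x ⬝ᵥ S.e 2 = 0 := (dotProduct_comm _ _).trans hx2
  have hsm : ContDiff ℝ ∞ fun s : ℝ => x + s • S.e 2 := by fun_prop
  have hdot : ∀ s : ℝ, x ⬝ᵥ (x + s • S.e 2) = x ⬝ᵥ x := fun s => by simp [h2x]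
  have hdot2 : ∀ s : ℝ, S.e 2 ⬝ᵥ (x + s • S.e 2) = s := fun s => by simp [hx2, S.dot_e]
  have hne : ∀ s : ℝ, x + s • S.e 2 ≠ 0 := fun s h => by
    have := hdot s
    rw [h, dotProduct_zero] at this
    exact hxx this.symm
  let c : ℝ → RP2 := fun s => S.F (pt (x + s • S.e 2))
  have hc : ContMDiff 𝓘(ℝ, ℝ) (𝓡 2) ∞ c := S.F.contMDiff_toFun.comp (contMDiff_pt_comp hsm hne)
  have hc0 : c 0 = pt (S.g x) := by simp [c, S.pt_g x hx]
  have h1 := hasDerivAt_comp (S.contMDiff_quad x (S.e 2)) hc 0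
  have hq : ∀ s, S.quad x (S.e 2) (c s) = (x ⬝ᵥ x) * s / (x ⬝ᵥ x + s * s) := by
    intro s
    rw [quad]
    simp only [c, Diffeomorph.symm_apply_apply]
    rw [RP2.quad_pt _ _ (hne s), hdot, hdot2, add_dotProduct, hdot, smul_dotProduct, hdot2,
      smul_eq_mul]
  have h2 : HasDerivAt (fun s => S.quad x (S.e 2) (c s)) 1 0 := by
    simp only [hq]
    have hn : HasDerivAt (fun s : ℝ => (x ⬝ᵥ x) * s) (x ⬝ᵥ x) 0 := by
      simpa using (hasDerivAt_id (0 : ℝ)).const_mul (x ⬝ᵥ x)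
    have hd : HasDerivAt (fun s : ℝ => x ⬝ᵥ x + s * s) 0 0 := by
      simpa using ((hasDerivAt_id (0 : ℝ)).mul (hasDerivAt_id 0)).const_add (x ⬝ᵥ x)
    have := hn.div hd (by simpa using hxx)
    simp only [mul_zero, sub_zero, add_zero] at this
    have h1 : (x ⬝ᵥ x) * (x ⬝ᵥ x) / (x ⬝ᵥ x) ^ 2 = 1 := by field_simp
    exact h1 ▸ this
  intro h0
  rw [hc0, h0] at h1
  exact zero_ne_one (h1.unique h2)

theorem differential_quad_vel (x : Fin 3 → ℝ) {c : ℝ → RP2} (hc : ContMDiff 𝓘(ℝ, ℝ) (𝓡 2) ∞ c)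
    (hcL : ∀ t, c t ∈ L) (t : ℝ) : differential (S.quad x (S.e 2)) (c t) (vel c t) = 0 := by
  have h1 := hasDerivAt_comp (S.contMDiff_quad x (S.e 2)) hc t
  have h2 : (fun s => S.quad x (S.e 2) (c s)) = fun _ => 0 :=
    funext fun s => S.quad_eq_zero x (hcL s)
  rw [h2] at h1
  exact h1.unique (hasDerivAt_const t 0)

/-- The angular speed of a tangent vector of `L`, up to a factor `2`. -/
def angular (p : RP2) (u : EuclideanSpace ℝ (Fin 2)) : ℝ :=
  (S.quad (S.e 0) (S.e 0) p - S.quad (S.e 1) (S.e 1) p) * differential (S.quad (S.e 0) (S.e 1)) p u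
  - S.quad (S.e 0) (S.e 1) p * (differential (S.quad (S.e 0) (S.e 0)) p u -
      differential (S.quad (S.e 1) (S.e 1)) p u)

theorem angular_smul (p : RP2) (r : ℝ) (u : EuclideanSpace ℝ (Fin 2)) :
    S.angular p (r • u) = r * S.angular p u := by
  simp only [angular, map_smul, smul_eq_mul]
  ring

/-- On `L` the angle is defined only modulo π, but the quadratic functions see cos 2θ and sin 2θ /
2. In these terms the expression is cos² 2θ + sin² 2θ. -/
theorem angular_curve (θ : ℝ) : S.angular (S.curve θ) (vel S.curve θ) = 1 := by
  have hd : ∀ x y : Fin 3 → ℝ, HasDerivAt (fun θ => (x ⬝ᵥ S.circle θ) * (y ⬝ᵥ S.circle θ))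
      (differential (S.quad x y) (S.curve θ) (vel S.curve θ)) θ := by
    intro x y
    have := hasDerivAt_comp (S.contMDiff_quad x y) S.contMDiff_curve θ
    simpa only [S.quad_curve] using this
  have h00 := hd (S.e 0) (S.e 0)
  have h01 := hd (S.e 0) (S.e 1)
  have h11 := hd (S.e 1) (S.e 1)
  simp only [dot_circle_zero, dot_circle_one] at h00 h01 h11
  rw [angular, h00.unique ((Real.hasDerivAt_cos θ).mul (Real.hasDerivAt_cos θ)),
    h01.unique ((Real.hasDerivAt_cos θ).mul (Real.hasDerivAt_sin θ)),
    h11.unique ((Real.hasDerivAt_sin θ).mul (Real.hasDerivAt_sin θ))]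
  simp only [quad_curve, dot_circle_zero, dot_circle_one]
  have := Real.sin_sq_add_cos_sq θ
  have h2 : (Real.sin θ ^ 2 + Real.cos θ ^ 2) ^ 2 = 1 := by rw [this]; norm_num
  linear_combination h2

theorem vel_curve_ne_zero (θ : ℝ) : vel S.curve θ ≠ 0 := by
  intro h
  have := S.angular_curve θ
  rw [h, ← zero_smul ℝ (0 : EuclideanSpace ℝ (Fin 2)), angular_smul, zero_mul] at this
  exact zero_ne_one this

/-- Both velocities lie in the kernel of the differential of a local equation of `L`, which is a
line. The coefficient is given by `angular`, a formula that involves no choice of angle and so can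
be seen to vary continuously. -/
theorem vel_eq_smul {c : ℝ → RP2} (hc : ContMDiff 𝓘(ℝ, ℝ) (𝓡 2) ∞ c) (hcL : ∀ t, c t ∈ L)
    {t θ : ℝ} (h : S.curve θ = c t) : vel c t = S.angular (c t) (vel c t) • vel S.curve θ := by
  have hne := S.differential_quad_ne_zero (S.circle_ne_zero θ) (S.dot_circle_two θ)
  change differential _ (S.curve θ) ≠ 0 at hne
  obtain ⟨r, hr⟩ := exists_smul_of_mem_ker _ hne
    (S.differential_quad_vel (S.circle θ) S.contMDiff_curve S.curve_mem θ) (S.vel_curve_ne_zero θ)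
    (by rw [h]; exact S.differential_quad_vel (S.circle θ) hc hcL t)
  have : S.angular (c t) (vel c t) = r := by
    rw [hr, ← h, angular_smul, S.angular_curve, mul_one]
  rw [this, hr]

theorem vel_curve_eq {θ θ' : ℝ} (h : S.curve θ = S.curve θ') :
    vel S.curve θ' = vel S.curve θ := by
  have := S.vel_eq_smul S.contMDiff_curve S.curve_mem h
  rwa [S.angular_curve, one_smul] at this

end Straightening

/-! ### The two orientations of a pseudoline -/

theorem curveOrientation_ext {L : Set RP2} {o o' : CurveOrientation L} (h : ∀ p, o.dir p = o'.dir p) :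
    o = o' := by
  cases o
  cases o'
  congr
  exact funext h

theorem units_cast_ne_zero (ε : ℤˣ) : ((ε : ℤ) : ℝ) ≠ 0 := by
  rcases Int.units_eq_one_or ε with rfl | rfl <;> simp

theorem units_cast_mul_self (ε : ℤˣ) : ((ε : ℤ) : ℝ) * ((ε : ℤ) : ℝ) = 1 := by
  rcases Int.units_eq_one_or ε with rfl | rfl <;> simp

namespace Straightening

variable {L : Set RP2} (S : Straightening L)

theorem smul_vel_curve_ne_zero (ε : ℤˣ) (θ : ℝ) : ((ε : ℤ) : ℝ) • vel S.curve θ ≠ 0 :=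
  smul_ne_zero (units_cast_ne_zero ε) (S.vel_curve_ne_zero θ)

/-- A parameter of a point of `L`. -/
def param (p : L) : ℝ := (S.exists_curve_eq p.2).choose

theorem curve_param (p : L) : S.curve (S.param p) = p := (S.exists_curve_eq p.2).choose_spec

/-- The direction of motion `ε` times that of the standard parametrization. -/
def ray (ε : ℤˣ) (θ : ℝ) : Module.Ray ℝ (EuclideanSpace ℝ (Fin 2)) :=
  rayOfNeZero ℝ (((ε : ℤ) : ℝ) • vel S.curve θ) (S.smul_vel_curve_ne_zero ε θ)

theorem ray_congr (ε : ℤˣ) {θ θ' : ℝ} (h : S.curve θ = S.curve θ') : S.ray ε θ = S.ray ε θ' := by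
  unfold ray
  congr 2
  exact (S.vel_curve_eq h).symm

theorem ray_neg (ε : ℤˣ) (θ : ℝ) : S.ray (-ε) θ = -S.ray ε θ := by
  rw [ray, ray, neg_rayOfNeZero]
  congr 1
  simp

/-- The orientation of `L` by its standard parametrization or its reverse. -/
def orient (ε : ℤˣ) : CurveOrientation L where
  dir p := S.ray ε (S.param p)
  exists_param := by
    refine ⟨fun t => S.curve ((ε : ℤ) * t), ?_, ?_, fun t h => ?_⟩
    · have hl : ContDiff ℝ ∞ fun s : ℝ => ((ε : ℤ) : ℝ) * s := by fun_prop
      exact S.contMDiff_curve.comp hl.contMDiff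
    · refine Eq.trans ?_ S.range_curve
      refine Subset.antisymm (range_subset_iff.2 fun t => mem_range_self _)
        (range_subset_iff.2 fun t => ⟨(ε : ℤ) * t, ?_⟩)
      simp only [← mul_assoc, units_cast_mul_self, one_mul]
    · have hv : vel (fun t => S.curve ((ε : ℤ) * t)) t =
          ((ε : ℤ) : ℝ) • vel S.curve ((ε : ℤ) * t) := vel_comp_mul S.contMDiff_curve _ t
      have hne : vel (fun t => S.curve ((ε : ℤ) * t)) t ≠ 0 := by
        rw [hv]
        exact S.smul_vel_curve_ne_zero ε _
      refine ⟨hne, ?_⟩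
      have h1 := S.ray_congr ε (S.curve_param ⟨_, h⟩)
      refine h1.trans ?_
      have h2 : rayOfNeZero ℝ (vel (fun t => S.curve ((ε : ℤ) * t)) t) hne =
          S.ray ε ((ε : ℤ) * t) := by
        unfold ray
        congr 1
      exact h2.symm

theorem orient_dir (ε : ℤˣ) {θ : ℝ} {p : L} (h : S.curve θ = p) :
    (S.orient ε).dir p = S.ray ε θ :=
  S.ray_congr ε ((S.curve_param p).trans h.symm)

theorem orient_neg_dir (ε : ℤˣ) (p : L) : (S.orient (-ε)).dir p = -(S.orient ε).dir p :=
  S.ray_neg ε _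

theorem orient_injective : Function.Injective S.orient := by
  intro ε ε' h
  by_contra hne
  have h1 : ε' = -ε := by
    rcases Int.units_eq_one_or ε with rfl | rfl <;>
      rcases Int.units_eq_one_or ε' with rfl | rfl <;> simp_all
  let p : L := ⟨S.curve 0, S.curve_mem 0⟩
  have h2 : S.ray ε (S.param p) = -S.ray ε (S.param p) := by
    rw [← S.ray_neg, ← h1]
    exact congrArg (fun o : CurveOrientation L => o.dir p) h
  exact Module.Ray.ne_neg_self _ h2

/-- The speed of the given parametrization relative to the standard one is continuous and never
zero, hence of constant sign. That sign is `ε`. -/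
theorem exists_orient_eq (o : CurveOrientation L) : ∃ ε, o = S.orient ε := by
  obtain ⟨γ, hγ, hr, hdir⟩ := o.exists_param
  have hγL : ∀ t, γ t ∈ L := fun t => hr ▸ mem_range_self t
  have hvne : ∀ t, vel γ t ≠ 0 := fun t => (hdir t (hγL t)).choose
  have hodir : ∀ t, o.dir ⟨γ t, hγL t⟩ = rayOfNeZero ℝ (vel γ t) (hvne t) := fun t =>
    (hdir t (hγL t)).choose_spec
  let w : ℝ → ℝ := fun t => S.angular (γ t) (vel γ t)
  have hw : ∀ t θ, S.curve θ = γ t → vel γ t = w t • vel S.curve θ := fun t θ h =>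
    S.vel_eq_smul hγ hγL h
  have hw0 : ∀ t, w t ≠ 0 := by
    intro t h
    obtain ⟨θ, hθ⟩ := S.exists_curve_eq (hγL t)
    exact hvne t (by rw [hw t θ hθ, h, zero_smul])
  have hcont : Continuous w := by
    have hq : ∀ x y, ContDiff ℝ ∞ fun t => S.quad x y (γ t) := fun x y =>
      ((S.contMDiff_quad x y).comp hγ).contDiff
    have hd : ∀ x y, Continuous fun t => differential (S.quad x y) (γ t) (vel γ t) := by
      intro x y
      have h1 : (fun t => differential (S.quad x y) (γ t) (vel γ t)) =
          deriv fun t => S.quad x y (γ t) :=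
        funext fun t => (hasDerivAt_comp (S.contMDiff_quad x y) hγ t).deriv.symm
      rw [h1]
      exact (hq x y).continuous_deriv (by simp)
    exact (((hq _ _).continuous.sub (hq _ _).continuous).mul (hd _ _)).sub
      ((hq _ _).continuous.mul ((hd _ _).sub (hd _ _)))
  obtain ⟨ε, hε⟩ : ∃ ε : ℤˣ, ∀ t, 0 < (ε : ℤ) * w t := by
    rcases (hw0 0).lt_or_gt with h | h
    · refine ⟨-1, fun t => ?_⟩
      by_contra! ht
      have ht' : 0 ≤ w t := by simpa using ht
      obtain ⟨s, hs⟩ := mem_range_of_exists_le_of_exists_ge hcont ⟨0, h.le⟩ ⟨t, ht'⟩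
      exact hw0 s hs
    · refine ⟨1, fun t => ?_⟩
      by_contra! ht
      have ht' : w t ≤ 0 := by simpa using ht
      obtain ⟨s, hs⟩ := mem_range_of_exists_le_of_exists_ge hcont ⟨t, ht'⟩ ⟨0, h.le⟩
      exact hw0 s hs
  refine ⟨ε, curveOrientation_ext ?_⟩
  rintro ⟨p, hp⟩
  obtain ⟨t, rfl⟩ : p ∈ range γ := hr ▸ hp
  obtain ⟨θ, hθ⟩ := S.exists_curve_eq hp
  suffices h : rayOfNeZero ℝ (vel γ t) (hvne t) = S.ray ε θ from
    (hodir t).trans (h.trans (S.orient_dir ε (p := ⟨γ t, hp⟩) hθ).symm)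
  rw [ray, ray_eq_iff, hw t θ hθ]
  have h1 : w t • vel S.curve θ = ((ε : ℤ) * w t) • (((ε : ℤ) : ℝ) • vel S.curve θ) := by
    rw [smul_smul, mul_right_comm, units_cast_mul_self, one_mul]
  rw [h1]
  exact SameRay.sameRay_pos_smul_left _ (hε t)

end Straightening
end RP2

/-! ### Connectedness of the digons -/

/-- A set `P` that is locally connected along a connected part `A` of its boundary, and closed
elsewhere in a connected set `H`, is connected. -/
theorem isPreconnected_of_side {X : Type*} [TopologicalSpace X] {H P A : Set X} (hH : IsPreconnected H)
    (hPo : IsOpen P) (hPH : P ⊆ H) (hAH : A ⊆ H) (hA : IsPreconnected A)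
    (hA0 : A.Nonempty) (hAP : Disjoint A P) (hcl : closure P ∩ H ⊆ P ∪ A)
    (hAcl : A ⊆ closure P) (hloc : ∀ x ∈ A, ∃ B ∈ 𝓝 x, IsPreconnected (B ∩ P)) :
    IsPreconnected P := by
  intro u v hu hv huv hPu hPv
  by_contra hdis
  rw [not_nonempty_iff_eq_empty] at hdis
  -- If `A` missed the closure of `P ∩ u`, this piece would be open and closed in the connected set
  -- `H`, hence all of `H`, although `A` lies in `H` and is disjoint from `P`.
  have key : ∀ u v : Set X, IsOpen u → IsOpen v → P ⊆ u ∪ v → (P ∩ u).Nonempty →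
      P ∩ (u ∩ v) = ∅ → (A ∩ closure (P ∩ u)).Nonempty := by
    intro u v hu hv huv hPu hdis
    by_contra hemp
    rw [not_nonempty_iff_eq_empty] at hemp
    have hsub : closure (P ∩ u) ∩ H ⊆ P ∩ u := by
      rintro x ⟨hx, hxH⟩
      have hxP : x ∈ P := by
        rcases hcl ⟨closure_mono inter_subset_left hx, hxH⟩ with h | h
        · exact h
        · exact absurd (show x ∈ A ∩ closure (P ∩ u) from ⟨h, hx⟩) (by simp [hemp])
      refine ⟨hxP, (huv hxP).resolve_right fun hxv => ?_⟩
      obtain ⟨y, hyv, hy⟩ := mem_closure_iff.1 hx v hv hxv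
      exact absurd (show y ∈ P ∩ (u ∩ v) from ⟨hy.1, hy.2, hyv⟩) (by simp [hdis])
    have hHsub : H ⊆ P ∩ u := by
      by_contra hn
      obtain ⟨y, hyH, hy⟩ := not_subset.1 hn
      obtain ⟨x, hxP, hxu⟩ := hPu
      obtain ⟨z, hzH, hz1, hz2⟩ := hH (P ∩ u) (closure (P ∩ u))ᶜ (hPo.inter hu)
        isClosed_closure.isOpen_compl
        (fun w hw => by
          by_cases hw' : w ∈ closure (P ∩ u)
          · exact Or.inl (hsub ⟨hw', hw⟩)
          · exact Or.inr hw')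
        ⟨x, hPH hxP, hxP, hxu⟩ ⟨y, hyH, fun h => hy (hsub ⟨h, hyH⟩)⟩
      exact hz2 (subset_closure hz1)
    obtain ⟨a, ha⟩ := hA0
    exact disjoint_left.1 hAP ha (hHsub (hAH ha)).1
  have h1 := key u v hu hv huv hPu hdis
  have h2 := key v u hv hu (by rwa [union_comm]) hPv (by rwa [inter_comm v u])
  have hcov : A ⊆ closure (P ∩ u) ∪ closure (P ∩ v) := by
    rw [← closure_union, ← inter_union_distrib_left, inter_eq_left.2 huv]
    exact hAcl
  -- Since `A` is connected, both pieces accumulate at a common point of `A`; there the local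
  -- connectedness of `P` contradicts the separation.
  obtain ⟨x, hxA, hxu, hxv⟩ :=
    isPreconnected_closed_iff.1 hA _ _ isClosed_closure isClosed_closure hcov h1 h2
  obtain ⟨B, hB, hBP⟩ := hloc x hxA
  obtain ⟨y, hyB, hyP, hyu⟩ := mem_closure_iff_nhds.1 hxu B hB
  obtain ⟨z, hzB, hzP, hzv⟩ := mem_closure_iff_nhds.1 hxv B hB
  obtain ⟨w, hw, hwuv⟩ := hBP u v hu hv (fun w hw => huv hw.2) ⟨y, ⟨hyB, hyP⟩, hyu⟩
    ⟨z, ⟨hzB, hzP⟩, hzv⟩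
  exact absurd (show w ∈ P ∩ (u ∩ v) from ⟨hw.2, hwuv⟩) (by simp [hdis])

/-- A continuous `π`-antiperiodic function with the zeros of a sine is a positive multiple of a
sine. -/
theorem exists_pos_mul_sin {φ : ℝ → ℝ} (hφ : Continuous φ) (hanti : ∀ t, φ (t + Real.pi) = -φ t)
    {z : ℝ} (hz : φ z = 0) (hzero : ∀ t, φ t = 0 → Real.sin (t - z) = 0) :
    ∃ θ, ∀ t, ∃ c > 0, φ t = c * Real.sin (t - θ) := by
  have main : ∀ ψ : ℝ → ℝ, (∀ t, ψ (t + Real.pi) = -ψ t) → ψ z = 0 →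
      (∀ t, z < t → t < z + Real.pi → 0 < ψ t) →
      ∀ t, ∃ c > 0, ψ t = c * Real.sin (t - z) := by
    intro ψ h1 h2 h3 t
    have hcase : ∀ t, z ≤ t → t < z + Real.pi → ∃ c > 0, ψ t = c * Real.sin (t - z) := by
      intro t ht1 ht2
      rcases ht1.eq_or_lt with rfl | ht1
      · exact ⟨1, one_pos, by simp [h2]⟩
      · have hs : 0 < Real.sin (t - z) :=
          Real.sin_pos_of_pos_of_lt_pi (by linarith) (by linarith)
        exact ⟨ψ t / Real.sin (t - z), div_pos (h3 t ht1 ht2) hs, by field_simp⟩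
    have hstep : ∀ t, (∃ c > 0, ψ t = c * Real.sin (t - z)) ↔
        ∃ c > 0, ψ (t + Real.pi) = c * Real.sin (t + Real.pi - z) := by
      intro t
      have h4 : Real.sin (t + Real.pi - z) = -Real.sin (t - z) := by
        rw [← Real.sin_add_pi]
        ring_nf
      simp only [h1, h4, mul_neg, neg_inj]
    -- Both sides change sign under a shift by π, so one half-period suffices.
    obtain ⟨k, hk, -⟩ := existsUnique_add_zsmul_mem_Ico Real.pi_pos t z
    have hint : ∀ k : ℤ, (∃ c > 0, ψ t = c * Real.sin (t - z)) ↔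
        ∃ c > 0, ψ (t + k • Real.pi) = c * Real.sin (t + k • Real.pi - z) := by
      intro k
      induction k with
      | zero => simp
      | succ i ih =>
        rw [ih, hstep, add_smul, one_smul, add_assoc]
      | pred i ih =>
        rw [ih, hstep (t + (-(i : ℤ) - 1) • Real.pi)]
        have : t + (-(i : ℤ) - 1) • Real.pi + Real.pi = t + (-(i : ℤ)) • Real.pi := by
          rw [sub_smul, one_smul]
          ring
        rw [this]
    exact (hint k).2 (hcase _ hk.1 hk.2)
  have hne : ∀ t, z < t → t < z + Real.pi → φ t ≠ 0 := fun t h1 h2 h =>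
    (Real.sin_pos_of_pos_of_lt_pi (by linarith) (by linarith)).ne' (hzero t h)
  have hpc : IsPreconnected (φ '' Ioo z (z + Real.pi)) :=
    isPreconnected_Ioo.image _ hφ.continuousOn
  have hord := hpc.ordConnected
  have hpi := Real.pi_pos
  have hmid : z + Real.pi / 2 ∈ Ioo z (z + Real.pi) := ⟨by linarith, by linarith⟩
  have h0 : (0 : ℝ) ∉ φ '' Ioo z (z + Real.pi) := by
    rintro ⟨t, ht, h⟩
    exact hne t ht.1 ht.2 h
  -- The sign of `φ` is constant between consecutive zeros. If it is negative after `z`, then the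
  -- upward crossing is at `z + π`.
  rcases (hne _ hmid.1 hmid.2).lt_or_gt with h | h
  · refine ⟨z + Real.pi, fun t => ?_⟩
    obtain ⟨c, hc, hct⟩ := main (fun t => -φ t) (fun t => by simp [hanti]) (by simp [hz])
      (fun t h1 h2 => by
        by_contra! h3
        exact h0 (hord.out (mem_image_of_mem φ hmid) (mem_image_of_mem φ ⟨h1, h2⟩)
          ⟨h.le, by simpa using h3⟩)) t
    refine ⟨c, hc, ?_⟩
    rw [show t - (z + Real.pi) = t - z - Real.pi by ring, Real.sin_sub_pi]
    linarith
  · refine ⟨z, main φ hanti hz fun t h1 h2 => ?_⟩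
    by_contra! h3
    exact h0 (hord.out (mem_image_of_mem φ ⟨h1, h2⟩) (mem_image_of_mem φ hmid) ⟨h3, h.le⟩)

namespace RP2
namespace Straightening

variable {L M : Set RP2} (S : Straightening L) (T : Straightening M)

theorem sin_sub_eq_zero_of_curve_eq {t z : ℝ} (h : S.curve t = S.curve z) :
    Real.sin (t - z) = 0 := by
  obtain ⟨r, -, hr⟩ := exists_smul_of_pt_eq (S.lift_ne_zero t) (S.lift_ne_zero z) h
  rw [lift, lift, ← S.g_smul] at hr
  have h1 := S.g.injective hr
  have h2 := congrArg (fun v => S.e 0 ⬝ᵥ v) h1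
  have h3 := congrArg (fun v => S.e 1 ⬝ᵥ v) h1
  simp only [dotProduct_smul, dot_circle_zero, dot_circle_one, smul_eq_mul] at h2 h3
  rw [Real.sin_sub, h2, h3]
  ring

/-- A single crossing leaves one zero per half-period. The angle `θ` singles out, of the two
opposite lifts of the crossing, the one at which `T.f` passes from negative to positive. -/
theorem exists_f_lift_eq {p : RP2} (h : L ∩ M = {p}) :
    ∃ θ, ∀ t, ∃ c > 0, T.f (S.lift t) = c * Real.sin (t - θ) := by
  have hp : p ∈ L ∩ M := h ▸ mem_singleton p
  obtain ⟨z, hz⟩ := S.exists_curve_eq hp.1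
  refine exists_pos_mul_sin (T.continuous_f.comp S.continuous_lift)
    (fun t => by simp [lift_add_pi, f_neg]) (z := z) ?_ fun t ht => ?_
  · rw [← T.pt_mem_iff (S.lift_ne_zero z)]
    exact (show pt (S.lift z) = p from hz) ▸ hp.2
  · refine S.sin_sub_eq_zero_of_curve_eq ?_
    have : S.curve t ∈ L ∩ M := ⟨S.curve_mem t, (T.pt_mem_iff (S.lift_ne_zero t)).2 ht⟩
    rw [h] at this
    rw [hz]
    exact this

theorem f_zero : S.f 0 = 0 := by simpa using S.f_smul 0 0

theorem isPreconnected_half : IsPreconnected {v | 0 < S.f v} := by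
  have h1 : {v | 0 < S.f v} = S.g '' {v | 0 < S.e 2 ⬝ᵥ v} := by
    rw [Homeomorph.image_eq_preimage_symm]
    rfl
  rw [h1]
  refine IsPreconnected.image ?_ _ S.g.continuous.continuousOn
  refine (convex_halfSpace_gt (f := fun v => S.e 2 ⬝ᵥ v) ⟨fun x y => ?_, fun c x => ?_⟩ 0).isPreconnected
  · exact dotProduct_add _ _ _
  · exact dotProduct_smul _ _ _

theorem lift_add_zsmul_two_pi (t : ℝ) (k : ℤ) : S.lift (t + k • (2 * Real.pi)) = S.lift t := by
  have h : Function.Periodic S.lift (2 * Real.pi) := fun t => by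
    rw [two_mul, ← add_assoc, lift_add_pi, lift_add_pi, neg_neg]
  exact h.zsmul k t

/-- Exhibits the part of the cone over `M` on the positive side of `L` as a single connected sector;
this is the boundary piece `A` in `isPreconnected_of_side`. -/
theorem arc_eq {θ : ℝ} (hθ : ∀ t, ∃ c > 0, S.f (T.lift t) = c * Real.sin (t - θ)) :
    {v | 0 < S.f v ∧ T.f v = 0} =
      (fun q : ℝ × ℝ => q.1 • T.lift q.2) '' (Ioi 0 ×ˢ Ioo θ (θ + Real.pi)) := by
  ext v
  constructor
  · rintro ⟨hv, hv'⟩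
    have hv0 : v ≠ 0 := by
      rintro rfl
      simp [S.f_zero] at hv
    obtain ⟨r, t, hr, rfl⟩ := T.exists_lift_of_f_eq_zero hv0 hv'
    obtain ⟨k, hk, -⟩ := existsUnique_add_zsmul_mem_Ico (show 0 < 2 * Real.pi by positivity) t θ
    obtain ⟨c, hc, hct⟩ := hθ (t + k • (2 * Real.pi))
    rw [lift_add_zsmul_two_pi] at hct
    rw [f_smul, hct] at hv
    have hs : 0 < Real.sin (t + k • (2 * Real.pi) - θ) := by
      by_contra! h
      have := mul_nonpos_of_nonneg_of_nonpos hc.le h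
      nlinarith
    refine ⟨(r, t + k • (2 * Real.pi)), ⟨hr, ?_, ?_⟩, by simp only [lift_add_zsmul_two_pi]⟩
    · rcases hk.1.eq_or_lt with h | h
      · rw [← h, sub_self, Real.sin_zero] at hs
        exact absurd hs (lt_irrefl 0)
      · exact h
    · by_contra! h
      have : Real.sin (t + k • (2 * Real.pi) - θ) ≤ 0 := by
        rw [← neg_nonneg, ← Real.sin_sub_pi]
        exact Real.sin_nonneg_of_nonneg_of_le_pi (by simp only at h; linarith)
          (by have := hk.2; linarith)
      linarith
  · rintro ⟨⟨r, t⟩, ⟨hr, ht1, ht2⟩, rfl⟩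
    obtain ⟨c, hc, hct⟩ := hθ t
    have hs : 0 < Real.sin (t - θ) :=
      Real.sin_pos_of_pos_of_lt_pi (by simp only at ht1; linarith)
        (by simp only at ht2; linarith)
    refine ⟨?_, by simp [f_smul, f_lift]⟩
    simp only [f_smul, hct]
    exact mul_pos hr (mul_pos hc hs)

/-- Here `isPreconnected_of_side` is applied inside the half-space cut out by `S.f`. Near the arc,
`T.g` identifies the quarter with a ball cut by a linear half-space, which is convex. -/
theorem isPreconnected_quarter {θ : ℝ}
    (hθ : ∀ t, ∃ c > 0, S.f (T.lift t) = c * Real.sin (t - θ)) (ε : ℤˣ) :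
    IsPreconnected {v | 0 < S.f v ∧ 0 < ((ε : ℤ) : ℝ) * T.f v} := by
  have hHo : IsOpen {v | 0 < S.f v} := isOpen_lt continuous_const S.continuous_f
  have hεT : Continuous fun v => ((ε : ℤ) : ℝ) * T.f v := continuous_const.mul T.continuous_f
  have hpi := Real.pi_pos
  have hA := S.arc_eq T hθ
  refine isPreconnected_of_side (A := {v | 0 < S.f v ∧ T.f v = 0}) S.isPreconnected_half
    (hHo.inter (isOpen_lt continuous_const hεT)) (fun v hv => hv.1) (fun v hv => hv.1) ?_ ?_ ?_ ?_
    ?_ ?_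
  · rw [hA]
    refine (isPreconnected_Ioi.prod isPreconnected_Ioo).image _ (Continuous.continuousOn ?_)
    exact continuous_fst.smul (T.continuous_lift.comp continuous_snd)
  · rw [hA]
    exact ⟨_, (1, θ + Real.pi / 2), ⟨mem_Ioi.2 one_pos, by simp only; linarith,
      by simp only; linarith⟩, rfl⟩
  · rw [disjoint_left]
    rintro v ⟨-, hv⟩ ⟨-, hv'⟩
    simp [hv] at hv'
  · rintro v ⟨hv, hvH⟩
    have h1 : v ∈ {v | 0 ≤ ((ε : ℤ) : ℝ) * T.f v} :=
      (closure_minimal (fun v hv => hv.2.le) (isClosed_le continuous_const hεT)) hv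
    rcases (show 0 ≤ ((ε : ℤ) : ℝ) * T.f v from h1).eq_or_lt with h | h
    · exact Or.inr ⟨hvH, (mul_eq_zero.1 h.symm).resolve_left (units_cast_ne_zero ε)⟩
    · exact Or.inl ⟨hvH, h⟩
  · rintro v ⟨hv, hv'⟩
    -- Leaving the arc along the straightened normal makes `T.f` equal to `s * ε`.
    let c : ℝ → Fin 3 → ℝ := fun s => T.g (T.g.symm v + (s * (ε : ℤ)) • T.e 2)
    have hc : Continuous c := T.g.continuous.comp (by fun_prop)
    have hc0 : c 0 = v := by simp [c]
    have hct : Tendsto c (𝓝[>] 0) (𝓝 v) := hc0 ▸ hc.continuousWithinAt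
    refine mem_closure_of_tendsto hct ?_
    have h2 : ∀ᶠ s in 𝓝[>] (0 : ℝ), 0 < S.f (c s) := hct.eventually (hHo.mem_nhds hv)
    filter_upwards [h2, self_mem_nhdsWithin] with s hs1 hs2
    refine ⟨hs1, ?_⟩
    have h3 : T.f (c s) = s * (ε : ℤ) := by
      have h4 : T.e 2 ⬝ᵥ T.g.symm v = 0 := hv'
      simp [f, c, h4, T.dot_e]
    rw [h3, mul_left_comm, units_cast_mul_self, mul_one]
    exact hs2
  · rintro v ⟨hv, -⟩
    have h1 : T.g ⁻¹' {v | 0 < S.f v} ∈ 𝓝 (T.g.symm v) :=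
      T.g.continuous.continuousAt.preimage_mem_nhds (by
        rw [Homeomorph.apply_symm_apply]
        exact hHo.mem_nhds hv)
    obtain ⟨r, hr, hrB⟩ := Metric.mem_nhds_iff.1 h1
    refine ⟨T.g '' Metric.ball (T.g.symm v) r, ?_, ?_⟩
    · have := T.g.isOpenMap.image_mem_nhds (Metric.ball_mem_nhds (T.g.symm v) hr)
      rwa [Homeomorph.apply_symm_apply] at this
    · have h2 : T.g '' Metric.ball (T.g.symm v) r ∩
          {v | 0 < S.f v ∧ 0 < ((ε : ℤ) : ℝ) * T.f v} =
          T.g '' (Metric.ball (T.g.symm v) r ∩ {w | 0 < ((ε : ℤ) : ℝ) * (T.e 2 ⬝ᵥ w)}) := by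
        ext w
        constructor
        · rintro ⟨⟨y, hy, rfl⟩, -, hw⟩
          refine ⟨y, ⟨hy, ?_⟩, rfl⟩
          simpa [f] using hw
        · rintro ⟨y, ⟨hy, hy'⟩, rfl⟩
          exact ⟨⟨y, hy, rfl⟩, hrB hy, by simpa [f] using hy'⟩
      rw [h2]
      refine IsPreconnected.image (Convex.isPreconnected ?_) _ T.g.continuous.continuousOn
      refine (convex_ball _ _).inter (convex_halfSpace_gt
        (f := fun w => ((ε : ℤ) : ℝ) * (T.e 2 ⬝ᵥ w)) ⟨fun x y => ?_, fun c x => ?_⟩ 0)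
      · rw [dotProduct_add, mul_add]
      · rw [dotProduct_smul, smul_eq_mul, smul_eq_mul, mul_left_comm]

/-- The form whose positivity set is a digon. -/
def digonForm (ε : ℤˣ) (v : Fin 3 → ℝ) : ℝ := ((ε : ℤ) : ℝ) * (S.f v * T.f v)

theorem isEvenForm_digonForm (ε : ℤˣ) : IsEvenForm (S.digonForm T ε) where
  cont := continuous_const.mul (S.continuous_f.mul T.continuous_f)
  smul t v := by
    simp only [digonForm, f_smul]
    ring

/-- The digon on which the product of the defining functions has sign `ε`. -/
def side (ε : ℤˣ) : Set RP2 := posSet (S.digonForm T ε)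

theorem pt_mem_side {ε : ℤˣ} {v : Fin 3 → ℝ} (hv : v ≠ 0) :
    pt v ∈ S.side T ε ↔ 0 < ((ε : ℤ) : ℝ) * (S.f v * T.f v) :=
  (S.isEvenForm_digonForm T ε).mem_posSet hv

theorem isOpen_side (ε : ℤˣ) : IsOpen (S.side T ε) := (S.isEvenForm_digonForm T ε).isOpen_posSet

theorem disjoint_side {ε ε' : ℤˣ} (h : ε ≠ ε') : Disjoint (S.side T ε) (S.side T ε') := by
  rw [disjoint_left]
  intro p hp hp'
  obtain ⟨v, hv, rfl⟩ := exists_pt_eq p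
  rw [pt_mem_side _ _ hv] at hp hp'
  rcases Int.units_eq_one_or ε with rfl | rfl <;> rcases Int.units_eq_one_or ε' with rfl | rfl <;>
    simp_all
  · linarith
  · linarith

theorem mem_side_or {p : RP2} (hp : p ∈ (L ∪ M)ᶜ) : ∃ ε, p ∈ S.side T ε := by
  obtain ⟨v, hv, rfl⟩ := exists_pt_eq p
  simp only [mem_compl_iff, mem_union, S.pt_mem_iff hv, T.pt_mem_iff hv, not_or] at hp
  rcases (mul_ne_zero hp.1 hp.2).lt_or_gt with h | h
  · exact ⟨-1, by rw [pt_mem_side _ _ hv]; simpa using h⟩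
  · exact ⟨1, by rw [pt_mem_side _ _ hv]; simpa using h⟩

theorem side_subset (ε : ℤˣ) : S.side T ε ⊆ (L ∪ M)ᶜ := by
  intro p hp
  obtain ⟨v, hv, rfl⟩ := exists_pt_eq p
  rw [pt_mem_side _ _ hv] at hp
  simp only [mem_compl_iff, mem_union, S.pt_mem_iff hv, T.pt_mem_iff hv, not_or]
  constructor <;> intro h <;> simp [h] at hp

theorem isPreconnected_side {θ : ℝ}
    (hθ : ∀ t, ∃ c > 0, S.f (T.lift t) = c * Real.sin (t - θ)) (ε : ℤˣ) :
    IsPreconnected (S.side T ε) := by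
  have h1 : S.side T ε = pt '' {v | 0 < S.f v ∧ 0 < ((ε : ℤ) : ℝ) * T.f v} := by
    ext p
    constructor
    · intro hp
      obtain ⟨v, hv, rfl⟩ := exists_pt_eq p
      rw [pt_mem_side _ _ hv] at hp
      -- Of the two representatives `v` and `-v`, the one with positive `S.f` lies in the quarter.
      rcases lt_trichotomy (S.f v) 0 with h | h | h
      · refine ⟨-v, ⟨by rw [f_neg]; linarith, ?_⟩, pt_neg v⟩
        rw [f_neg]
        by_contra! h'
        nlinarith
      · simp [h] at hp
      · refine ⟨v, ⟨h, ?_⟩, rfl⟩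
        by_contra! h'
        nlinarith
    · rintro ⟨v, ⟨h1, h2⟩, rfl⟩
      have hv : v ≠ 0 := by
        rintro rfl
        simp [S.f_zero] at h1
      rw [pt_mem_side _ _ hv]
      nlinarith [mul_pos h1 h2]
  rw [h1]
  refine (S.isPreconnected_quarter T hθ ε).image _ (continuousOn_pt.mono ?_)
  rintro v ⟨h1, -⟩ rfl
  simp [S.f_zero] at h1

theorem side_nonempty {θ : ℝ} (hθ : ∀ t, ∃ c > 0, S.f (T.lift t) = c * Real.sin (t - θ))
    (ε : ℤˣ) : (S.side T ε).Nonempty := by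
  obtain ⟨c, hc, hct⟩ := hθ (θ + Real.pi / 2)
  have h0 : 0 < S.f (T.lift (θ + Real.pi / 2)) := by
    rw [hct]
    simpa using hc
  let d : ℝ → Fin 3 → ℝ := fun s => T.g (T.circle (θ + Real.pi / 2) + (s * (ε : ℤ)) • T.e 2)
  have hd : Continuous d := T.g.continuous.comp (by fun_prop)
  have hd0 : d 0 = T.lift (θ + Real.pi / 2) := by simp [d, lift]
  have h1 : ∀ᶠ s in 𝓝[>] (0 : ℝ), 0 < S.f (d s) := by
    have h2 : Tendsto (fun s => S.f (d s)) (𝓝[>] 0) (𝓝 (S.f (d 0))) :=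
      (S.continuous_f.comp hd).continuousWithinAt
    exact h2.eventually (lt_mem_nhds (hd0 ▸ h0))
  obtain ⟨s, hs1, hs2⟩ := (h1.and self_mem_nhdsWithin).exists
  have hs2' : (0 : ℝ) < s := hs2
  have hne : d s ≠ 0 := fun h => by simp [h, S.f_zero] at hs1
  refine ⟨pt (d s), (S.pt_mem_side T hne).2 ?_⟩
  have h3 : T.f (d s) = s * (ε : ℤ) := by simp [f, d, dot_circle_two, T.dot_e]
  rw [h3, show ((ε : ℤ) : ℝ) * (S.f (d s) * (s * (ε : ℤ))) =
    S.f (d s) * s * (((ε : ℤ) : ℝ) * ((ε : ℤ) : ℝ)) by ring, units_cast_mul_self]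
  nlinarith [mul_pos hs1 hs2']

/-- The two sides are open, disjoint, nonempty and connected, and they cover the complement of the
curves; so they are its components. -/
theorem isDigon_iff {θ : ℝ} (hθ : ∀ t, ∃ c > 0, S.f (T.lift t) = c * Real.sin (t - θ))
    (D : Set RP2) : IsDigon L M D ↔ ∃ ε, D = S.side T ε := by
  have key : ∀ ε x, x ∈ S.side T ε → connectedComponentIn (L ∪ M)ᶜ x = S.side T ε := by
    intro ε x hx
    refine Subset.antisymm ?_
      ((S.isPreconnected_side T hθ ε).subset_connectedComponentIn hx (S.side_subset T ε))
    refine isPreconnected_connectedComponentIn.subset_left_of_subset_union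
      (v := S.side T (-ε)) (S.isOpen_side T ε) (S.isOpen_side T (-ε)) (S.disjoint_side T ?_) ?_
      ⟨x, mem_connectedComponentIn (S.side_subset T ε hx), hx⟩
    · rcases Int.units_eq_one_or ε with rfl | rfl <;> decide
    · intro y hy
      obtain ⟨ε', hε'⟩ := S.mem_side_or T (connectedComponentIn_subset _ _ hy)
      by_cases h : ε' = ε
      · exact Or.inl (h ▸ hε')
      · have : ε' = -ε := by
          rcases Int.units_eq_one_or ε with rfl | rfl <;>
            rcases Int.units_eq_one_or ε' with rfl | rfl <;> simp_all
        exact Or.inr (this ▸ hε')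
  constructor
  · rintro ⟨x, hx, rfl⟩
    obtain ⟨ε, hε⟩ := S.mem_side_or T hx
    exact ⟨ε, key ε x hε⟩
  · rintro ⟨ε, rfl⟩
    obtain ⟨x, hx⟩ := S.side_nonempty T hθ ε
    exact ⟨x, S.side_subset T ε hx, (key ε x hx).symm⟩

end Straightening
end RP2

/-! ### Corners and induced orientations of digons -/

theorem HasDerivAt.eventually_mul_pos {φ : ℝ → ℝ} {d x : ℝ} (h : HasDerivAt φ d x) (hx : φ x = 0)
    (hd : d ≠ 0) : ∀ᶠ t in 𝓝[>] x, 0 < d * φ t := by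
  have h1 := h.tendsto_slope.mono_left (nhdsWithin_mono x fun t (ht : x < t) => ht.ne')
  have h2 : Tendsto (fun t => d * slope φ x t) (𝓝[>] x) (𝓝 (d * d)) := h1.const_mul d
  filter_upwards [h2.eventually (lt_mem_nhds (mul_self_pos.2 hd)), self_mem_nhdsWithin] with t ht htx
  rw [slope_def_field, hx, sub_zero, ← mul_div_assoc] at ht
  exact (div_pos_iff_of_pos_right (sub_pos.2 htx)).1 ht

theorem HasDerivAt.deriv_nonneg_of_eventually {φ : ℝ → ℝ} {d x : ℝ} (h : HasDerivAt φ d x)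
    (hx : φ x = 0) (hpos : ∀ᶠ t in 𝓝[>] x, 0 ≤ φ t) : 0 ≤ d := by
  have h1 : Tendsto (slope φ x) (𝓝[>] x) (𝓝 d) := h.tendsto_slope.mono_left (nhdsWithin_mono x fun t (ht : x < t) => ht.ne')
  refine ge_of_tendsto h1 ?_
  filter_upwards [hpos, self_mem_nhdsWithin] with t ht htx
  rw [slope_def_field, hx, sub_zero]
  exact div_nonneg ht (sub_pos.2 htx).le

namespace RP2
namespace Straightening

variable {L M : Set RP2} (S : Straightening L) (T : Straightening M)

theorem differential_eq_zero_of_mem_tangentSpan (x : Fin 3 → ℝ) {p : RP2}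
    {u : TangentSpace (𝓡 2) p} (hu : u ∈ tangentSpan L p) :
    differential (S.quad x (S.e 2)) p u = 0 := by
  have h : tangentSpan L p ≤ LinearMap.ker (mfderiv (𝓡 2) 𝓘(ℝ, ℝ) (S.quad x (S.e 2)) p).toLinearMap := by
    refine Submodule.span_le.2 ?_
    rintro u ⟨c, hc, hcL, rfl, rfl⟩
    exact S.differential_quad_vel x hc hcL 0
  exact h hu

theorem exists_smul_of_mem_tangentSpan {p : RP2} {θ : ℝ} (hθ : S.curve θ = p)
    {u : TangentSpace (𝓡 2) p} (hu : u ∈ tangentSpan L p) :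
    ∃ s : ℝ, (u : EuclideanSpace ℝ (Fin 2)) = s • vel S.curve θ := by
  let N : Submodule ℝ (TangentSpace (𝓡 2) p) :=
    { carrier := {u | ∃ s : ℝ, (u : EuclideanSpace ℝ (Fin 2)) = s • vel S.curve θ}
      zero_mem' := ⟨0, (zero_smul ℝ (vel S.curve θ)).symm⟩
      add_mem' := by
        rintro u v ⟨s, rfl⟩ ⟨t, rfl⟩
        exact ⟨s + t, (add_smul s t (vel S.curve θ)).symm⟩
      smul_mem' := by
        rintro r u ⟨s, rfl⟩
        exact ⟨r * s, smul_smul r s (vel S.curve θ)⟩ }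
  have h : tangentSpan L p ≤ N := by
    refine Submodule.span_le.2 ?_
    rintro u ⟨c, hc, hcL, rfl, rfl⟩
    exact ⟨_, S.vel_eq_smul hc hcL hθ⟩
  exact h hu

/-- Otherwise the differential of the local equation of `L` would vanish on both tangent lines,
which together span the plane by transversality. -/
theorem differential_vel_ne_zero {p : RP2} {θ η : ℝ} (hθ : S.curve θ = p) (hη : T.curve η = p)
    (htr : tangentSpan L p ⊔ tangentSpan M p = ⊤) :
    differential (S.quad (S.circle θ) (S.e 2)) p (vel T.curve η) ≠ 0 := by
  intro h0
  have hne := S.differential_quad_ne_zero (S.circle_ne_zero θ) (S.dot_circle_two θ)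
  change differential _ (S.curve θ) ≠ 0 at hne
  rw [hθ] at hne
  suffices h : ∀ w : TangentSpace (𝓡 2) p, differential (S.quad (S.circle θ) (S.e 2)) p w = 0 from
    hne (ContinuousLinearMap.ext h)
  intro w
  have hw : w ∈ tangentSpan L p ⊔ tangentSpan M p := by
    rw [htr]
    exact Submodule.mem_top
  obtain ⟨u, hu, v, hv, huv⟩ := Submodule.mem_sup.1 hw
  obtain ⟨s, hs⟩ := T.exists_smul_of_mem_tangentSpan hη hv
  have h1 : differential (S.quad (S.circle θ) (S.e 2)) p w =
      differential (S.quad (S.circle θ) (S.e 2)) p u +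
      differential (S.quad (S.circle θ) (S.e 2)) p v := by
    rw [← huv]
    exact map_add _ _ _
  rw [h1, S.differential_eq_zero_of_mem_tangentSpan _ hu, hs, map_smul, h0, smul_zero, add_zero]

/-- Fixes the sign of the derivative. Just after `η` the value of `S.f` on `T.lift` is positive,
while the other factor in the numerator of the local equation is close to `r`. So `r` times the
local equation is nonnegative there, and its derivative at `η` is nonnegative; transversality
excludes zero. -/
theorem mul_differential_vel_pos {p : RP2} {θ η r : ℝ} (hθ : S.curve θ = p) (hη : T.curve η = p)
    (htr : tangentSpan L p ⊔ tangentSpan M p = ⊤) (hr : r ≠ 0) (hlift : T.lift η = r • S.lift θ)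
    (hsin : ∀ t, ∃ c > 0, S.f (T.lift t) = c * Real.sin (t - η)) :
    0 < r * differential (S.quad (S.circle θ) (S.e 2)) p (vel T.curve η) := by
  have hne := S.differential_vel_ne_zero T hθ hη htr
  have h1 := hasDerivAt_comp (S.contMDiff_quad (S.circle θ) (S.e 2)) T.contMDiff_curve η
  rw [hη] at h1
  have h2 := h1.const_mul r
  refine lt_of_le_of_ne (h2.deriv_nonneg_of_eventually ?_ ?_) (mul_ne_zero hr hne).symm
  · rw [hη, ← hθ, S.quad_curve, S.dot_circle_two, mul_zero, mul_zero]
  · have hcont : Continuous fun t => r * (S.circle θ ⬝ᵥ S.g.symm (T.lift t)) :=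
      continuous_const.mul (continuous_const.dotProduct (S.g.symm.continuous.comp T.continuous_lift))
    have hval : 0 < r * (S.circle θ ⬝ᵥ S.g.symm (T.lift η)) := by
      rw [hlift, g_symm_smul, lift, Homeomorph.symm_apply_apply, dotProduct_smul, circle_dot_self,
        smul_eq_mul, mul_one]
      exact mul_self_pos.2 hr
    have hev : ∀ᶠ t in 𝓝[>] η, 0 < r * (S.circle θ ⬝ᵥ S.g.symm (T.lift t)) :=
      (hcont.continuousWithinAt.eventually (lt_mem_nhds hval))
    have hlt : ∀ᶠ t in 𝓝[>] η, t < η + Real.pi :=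
      nhdsWithin_le_nhds (gt_mem_nhds (by linarith [Real.pi_pos]))
    filter_upwards [hev, hlt, self_mem_nhdsWithin] with t ht htpi htη
    have htη' : η < t := htη
    obtain ⟨c, hc, hct⟩ := hsin t
    rw [curve, S.quad_pt _ _ (T.lift_ne_zero t)]
    change 0 ≤ r * ((S.circle θ ⬝ᵥ S.g.symm (T.lift t)) * S.f (T.lift t) / _)
    rw [hct, ← mul_div_assoc, ← mul_assoc]
    have hs : 0 < Real.sin (t - η) :=
      Real.sin_pos_of_pos_of_lt_pi (by linarith) (by linarith)
    exact div_nonneg (mul_pos ht (mul_pos hc hs)).le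
      (Finset.sum_nonneg fun i _ => mul_self_nonneg _)

theorem isEvenForm_orientation (θ η r : ℝ) : IsEvenForm fun v =>
    r * ((S.circle θ ⬝ᵥ S.g.symm v) * (T.circle η ⬝ᵥ T.g.symm v)) where
  cont := continuous_const.mul ((continuous_const.dotProduct S.g.symm.continuous).mul
    (continuous_const.dotProduct T.g.symm.continuous))
  smul t v := by
    simp only [g_symm_smul, dotProduct_smul, smul_eq_mul]
    ring

/-- A curve that leaves a crossing transversally to both curves runs into the digon determined by
its velocity. -/
theorem eventually_mem_side_iff {p : RP2} {θ η r : ℝ} (hθ : S.curve θ = p) (hη : T.curve η = p)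
    (htr : tangentSpan L p ⊔ tangentSpan M p = ⊤) (hr : r ≠ 0) (hlift : S.lift θ = r • T.lift η)
    (hS : ∀ t, ∃ c > 0, S.f (T.lift t) = c * Real.sin (t - η))
    (hT : ∀ t, ∃ c > 0, T.f (S.lift t) = c * Real.sin (t - θ))
    {c : ℝ → RP2} (hc : ContMDiff 𝓘(ℝ, ℝ) (𝓡 2) ∞ c) (hc0 : c 0 = p) {a b : ℝ} (ha : a ≠ 0)
    (hb : b ≠ 0) (hv : vel c 0 = a • vel S.curve θ + b • vel T.curve η) (ε : ℤˣ) :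
    ∀ᶠ t in 𝓝[>] (0 : ℝ), (c t ∈ S.side T ε ↔ 0 < ((ε : ℤ) : ℝ) * (r * (a * b))) := by
  set h := S.quad (S.circle θ) (S.e 2) with hh
  set k := T.quad (T.circle η) (T.e 2) with hk
  have hlift' : T.lift η = r⁻¹ • S.lift θ := by
    rw [hlift, smul_smul, inv_mul_cancel₀ hr, one_smul]
  set dS := differential h p (vel T.curve η) with hdS
  set dT := differential k p (vel S.curve θ) with hdT
  have hdSpos : 0 < r⁻¹ * dS :=
    S.mul_differential_vel_pos T hθ hη htr (inv_ne_zero hr) hlift' hS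
  have hdTpos : 0 < r * dT :=
    T.mul_differential_vel_pos S hη hθ (by rwa [sup_comm]) hr hlift hT
  -- The two derivatives have the signs of `r⁻¹` and `r`, so their product is positive.
  have hprod : 0 < dS * dT := by
    have h1 := mul_pos hdSpos hdTpos
    rwa [show r⁻¹ * dS * (r * dT) = (r⁻¹ * r) * (dS * dT) by ring, inv_mul_cancel₀ hr,
      one_mul] at h1
  have hdS0 : dS ≠ 0 := left_ne_zero_of_mul hprod.ne'
  have hdT0 : dT ≠ 0 := right_ne_zero_of_mul hprod.ne'
  have hd1 : HasDerivAt (fun t => h (c t)) (b * dS) 0 := by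
    have h1 := hasDerivAt_comp (S.contMDiff_quad (S.circle θ) (S.e 2)) hc 0
    have h2 := S.differential_quad_vel (S.circle θ) S.contMDiff_curve S.curve_mem θ
    rw [hθ] at h2
    rw [hv, hc0, map_add, map_smul, map_smul, h2, smul_zero, zero_add] at h1
    exact h1
  have hd2 : HasDerivAt (fun t => k (c t)) (a * dT) 0 := by
    have h1 := hasDerivAt_comp (T.contMDiff_quad (T.circle η) (T.e 2)) hc 0
    have h2 := T.differential_quad_vel (T.circle η) T.contMDiff_curve T.curve_mem η
    rw [hη] at h2
    rw [hv, hc0, map_add, map_smul, map_smul, h2, smul_zero, add_zero] at h1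
    exact h1
  have hpL : p ∈ L := hθ ▸ S.curve_mem θ
  have hpM : p ∈ M := hη ▸ T.curve_mem η
  have he1 := hd1.eventually_mul_pos (by rw [hc0]; exact S.quad_eq_zero _ hpL) (mul_ne_zero hb hdS0)
  have he2 := hd2.eventually_mul_pos (by rw [hc0]; exact T.quad_eq_zero _ hpM) (mul_ne_zero ha hdT0)
  have hB := S.isEvenForm_orientation T θ η r
  -- The auxiliary factors of the two local equations depend on the representative only through a
  -- common scaling, so the sign of their product is well defined. At `p`, hence nearby, it is the
  -- sign of `r`.
  have hpB : p ∈ posSet fun v => r * ((S.circle θ ⬝ᵥ S.g.symm v) * (T.circle η ⬝ᵥ T.g.symm v)) := by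
    rw [← hθ, curve, hB.mem_posSet (S.lift_ne_zero θ)]
    have h1 : S.g.symm (S.lift θ) = S.circle θ := by rw [lift, Homeomorph.symm_apply_apply]
    have h2 : T.g.symm (S.lift θ) = r • T.circle η := by
      rw [hlift, g_symm_smul, lift, Homeomorph.symm_apply_apply]
    rw [h1, h2, dotProduct_smul, circle_dot_self, circle_dot_self, smul_eq_mul, mul_one, one_mul]
    exact mul_self_pos.2 hr
  have he3 : ∀ᶠ t in 𝓝[>] (0 : ℝ), c t ∈ posSet fun v =>
      r * ((S.circle θ ⬝ᵥ S.g.symm v) * (T.circle η ⬝ᵥ T.g.symm v)) :=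
    hc.continuous.continuousWithinAt.eventually (hB.isOpen_posSet.mem_nhds (hc0 ▸ hpB))
  filter_upwards [he1, he2, he3] with t ht1 ht2 ht3
  obtain ⟨v, hv0, hvt⟩ := exists_pt_eq (c t)
  rw [← hvt] at ht1 ht2 ht3 ⊢
  rw [hB.mem_posSet hv0] at ht3
  rw [pt_mem_side _ _ hv0]
  rw [hh, S.quad_pt _ _ hv0] at ht1
  rw [hk, T.quad_pt _ _ hv0] at ht2
  change 0 < b * dS * ((S.circle θ ⬝ᵥ S.g.symm v) * S.f v / _) at ht1
  change 0 < a * dT * ((T.circle η ⬝ᵥ T.g.symm v) * T.f v / _) at ht2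
  have hn : ∀ w : Fin 3 → ℝ, 0 ≤ w ⬝ᵥ w := fun w => Finset.sum_nonneg fun i _ => mul_self_nonneg _
  have clear_div : ∀ x y z : ℝ, 0 ≤ z → 0 < x * (y / z) → 0 < x * y := by
    intro x y z hz hxy
    rw [← mul_div_assoc] at hxy
    by_contra! hcon
    exact absurd (div_nonpos_of_nonpos_of_nonneg hcon hz) (not_le.2 hxy)
  replace ht1 := clear_div _ _ _ (hn _) ht1
  replace ht2 := clear_div _ _ _ (hn _) ht2
  generalize S.circle θ ⬝ᵥ S.g.symm v = X at *
  generalize T.circle η ⬝ᵥ T.g.symm v = Y at *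
  generalize S.f v = f₁ at *
  generalize T.f v = f₂ at *
  -- Multiplying the three sign conditions leaves only this expression times a positive factor.
  have hpos : 0 < (r * (a * b)) * (f₁ * f₂) := by
    have h1 : 0 < (b * dS * (X * f₁)) * (a * dT * (Y * f₂)) * (r * (X * Y)) :=
      mul_pos (mul_pos ht1 ht2) ht3
    have h2 : (b * dS * (X * f₁)) * (a * dT * (Y * f₂)) * (r * (X * Y)) =
        (r * (a * b)) * (f₁ * f₂) * ((dS * dT) * (X * Y) ^ 2) := by ring
    rw [h2] at h1
    by_contra! h3
    exact absurd (mul_nonpos_of_nonpos_of_nonneg h3 (by positivity)) (not_le.2 h1)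
  rcases Int.units_eq_one_or ε with rfl | rfl
  · simp only [Units.val_one, Int.cast_one, one_mul]
    exact (pos_iff_pos_of_mul_pos hpos).symm
  · simp only [Units.val_neg, Units.val_one, Int.cast_neg, Int.cast_one, neg_mul, one_mul, neg_pos]
    exact (neg_iff_neg_of_mul_pos hpos).symm

/-- Every curve leaving `p` strictly between the two rays enters the same digon, so a single test
curve decides. -/
theorem hasCorner_side_iff {p : RP2} {θ η r : ℝ} (hθ : S.curve θ = p) (hη : T.curve η = p)
    (htr : tangentSpan L p ⊔ tangentSpan M p = ⊤) (hr : r ≠ 0) (hlift : S.lift θ = r • T.lift η)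
    (hS : ∀ t, ∃ c > 0, S.f (T.lift t) = c * Real.sin (t - η))
    (hT : ∀ t, ∃ c > 0, T.f (S.lift t) = c * Real.sin (t - θ)) (a b ε : ℤˣ) :
    HasCorner (S.side T ε) p (S.ray a θ) (T.ray b η) ↔
      0 < ((ε : ℤ) : ℝ) * (r * (((a : ℤ) : ℝ) * ((b : ℤ) : ℝ))) := by
  have hcast : ∀ (q : RP2) (hq : q = p) (v : TangentSpace (𝓡 2) q),
      ((hq ▸ v : TangentSpace (𝓡 2) p) : EuclideanSpace ℝ (Fin 2)) = v := by
    rintro q rfl v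
    rfl
  have hray : ∀ {N : Set RP2} (R : Straightening N) (a : ℤˣ) (θ : ℝ)
      (u : EuclideanSpace ℝ (Fin 2)) (hu : u ≠ 0), rayOfNeZero ℝ u hu = R.ray a θ →
      ∃ s : ℝ, 0 < s ∧ u = (s * (a : ℤ)) • vel R.curve θ := by
    intro N R a θ u hu h
    rw [ray, ray_eq_iff] at h
    obtain ⟨s, hs, h1⟩ := h.exists_pos_right hu (R.smul_vel_curve_ne_zero a θ)
    exact ⟨s, hs, by rw [h1, smul_smul]⟩
  constructor
  · intro h
    obtain ⟨c, hc, hc0, hcv⟩ := exists_curve_velocity p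
      ((((a : ℤ) : ℝ) • vel S.curve θ + ((b : ℤ) : ℝ) • vel T.curve η : EuclideanSpace ℝ (Fin 2)))
    have h1 := h c hc hc0 ⟨((a : ℤ) : ℝ) • vel S.curve θ, ((b : ℤ) : ℝ) • vel T.curve η,
      S.smul_vel_curve_ne_zero a θ, T.smul_vel_curve_ne_zero b η, rfl, rfl, hcv⟩
    have hv := (hcast _ hc0 (velocity c 0)).symm.trans hcv
    have h2 := S.eventually_mem_side_iff T hθ hη htr hr hlift hS hT hc hc0 (units_cast_ne_zero a)
      (units_cast_ne_zero b) hv ε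
    obtain ⟨t, ht1, ht2⟩ := (h1.and h2).exists
    exact ht2.1 ht1
  · rintro h c hc hc0 ⟨u, v, hu, hv, hur, hvr, hcv⟩
    obtain ⟨s, hs, hsu⟩ := hray S a θ u hu hur
    obtain ⟨s', hs', hsv⟩ := hray T b η v hv hvr
    have hv' : vel c 0 = (s * (a : ℤ)) • vel S.curve θ + (s' * (b : ℤ)) • vel T.curve η := by
      rw [← hsu, ← hsv]
      exact (hcast _ hc0 (velocity c 0)).symm.trans hcv
    have h2 := S.eventually_mem_side_iff T hθ hη htr hr hlift hS hT hc hc0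
      (mul_ne_zero hs.ne' (units_cast_ne_zero a)) (mul_ne_zero hs'.ne' (units_cast_ne_zero b)) hv' ε
    filter_upwards [h2] with t ht
    refine ht.2 ?_
    have := mul_pos (mul_pos hs hs') h
    rwa [show s * s' * (((ε : ℤ) : ℝ) * (r * (((a : ℤ) : ℝ) * ((b : ℤ) : ℝ)))) =
      ((ε : ℤ) : ℝ) * (r * (s * ((a : ℤ) : ℝ) * (s' * ((b : ℤ) : ℝ)))) by ring] at this

/-- Reversing both directions does not change the sign condition of `hasCorner_side_iff`, so the two
opposite corners impose the same condition, with the minus sign from the one reversed curve. -/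
theorem inducesBoundaryOrientation_iff {p : RP2} {θ η r : ℝ} (hp : L ∩ M = {p})
    (hθ : S.curve θ = p) (hη : T.curve η = p)
    (htr : tangentSpan L p ⊔ tangentSpan M p = ⊤) (hr : r ≠ 0) (hlift : S.lift θ = r • T.lift η)
    (hS : ∀ t, ∃ c > 0, S.f (T.lift t) = c * Real.sin (t - η))
    (hT : ∀ t, ∃ c > 0, T.f (S.lift t) = c * Real.sin (t - θ)) (a b ε : ℤˣ) :
    InducesBoundaryOrientation (S.orient a) (T.orient b) (S.side T ε) ↔
      ((ε : ℤ) : ℝ) * (r * (((a : ℤ) : ℝ) * ((b : ℤ) : ℝ))) < 0 := by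
  have key := S.hasCorner_side_iff T hθ hη htr hr hlift hS hT
  have hdS : ∀ a (h : p ∈ L), (S.orient a).dir ⟨p, h⟩ = S.ray a θ := fun a h => S.orient_dir a hθ
  have hdT : ∀ b (h : p ∈ M), (T.orient b).dir ⟨p, h⟩ = T.ray b η := fun b h => T.orient_dir b hη
  have hpLM : p ∈ L ∩ M := hp ▸ mem_singleton p
  have h1 : InducesBoundaryOrientation (S.orient a) (T.orient b) (S.side T ε) ↔
      HasCorner (S.side T ε) p (S.ray a θ) (T.ray (-b) η) ∧
      HasCorner (S.side T ε) p (S.ray (-a) θ) (T.ray b η) := by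
    constructor
    · intro h
      have := h p hpLM.1 hpLM.2
      rw [← orient_neg_dir, ← orient_neg_dir, hdS, hdS, hdT, hdT] at this
      exact this
    · intro h q hqL hqM
      have hq : q ∈ L ∩ M := ⟨hqL, hqM⟩
      rw [hp] at hq
      obtain rfl := mem_singleton_iff.1 hq
      rw [← orient_neg_dir, ← orient_neg_dir, hdS, hdS, hdT, hdT]
      exact h
  rw [h1, key, key]
  push_cast
  constructor
  · rintro ⟨h, -⟩
    linarith
  · intro h
    constructor <;> linarith

end Straightening
end RP2

/-! ### Parity and sign cocycles -/

section Combinatorics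

theorem mul_mul_mul_mul_mul_comm {G : Type*} [CommSemigroup G] (a b c d e f : G) :
    a * b * (c * d) * (e * f) = a * c * e * (b * d * f) := by
  rw [mul_mul_mul_comm a b c d, mul_mul_mul_comm]

variable {n : ℕ}

/-- The pairs of elements of `A`, in increasing order. -/
def orderedPairs (A : Finset (Fin n)) : Finset (Fin n × Fin n) :=
  (A ×ˢ A).filter fun q => q.1 < q.2

theorem mem_orderedPairs {A : Finset (Fin n)} {q : Fin n × Fin n} :
    q ∈ orderedPairs A ↔ (q.1 ∈ A ∧ q.2 ∈ A) ∧ q.1 < q.2 := by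
  simp [orderedPairs]

theorem card_orderedPairs (A : Finset (Fin n)) : (orderedPairs A).card = A.card.choose 2 := by
  rw [← Finset.card_powersetCard]
  refine Finset.card_bij (fun q _ => {q.1, q.2}) ?_ ?_ ?_
  · rintro ⟨s, t⟩ h
    rw [mem_orderedPairs] at h
    rw [Finset.mem_powersetCard, Finset.card_pair h.2.ne]
    refine ⟨?_, rfl⟩
    rw [Finset.insert_subset_iff, Finset.singleton_subset_iff]
    exact h.1
  · rintro ⟨s, t⟩ h ⟨s', t'⟩ h' heq
    rw [mem_orderedPairs] at h h'
    simp only at h h' heq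
    have h1 : s ∈ ({s', t'} : Finset (Fin n)) := heq ▸ Finset.mem_insert_self _ _
    have h2 : t ∈ ({s', t'} : Finset (Fin n)) := heq ▸ by simp
    simp only [Finset.mem_insert, Finset.mem_singleton] at h1 h2
    have := h.2
    have := h'.2
    rcases h1 with rfl | rfl <;> rcases h2 with rfl | rfl
    · omega
    · rfl
    · omega
    · omega
  · intro B hB
    rw [Finset.mem_powersetCard] at hB
    obtain ⟨s, t, hst, rfl⟩ := Finset.card_eq_two.1 hB.2
    have hs : s ∈ A := hB.1 (by simp)
    have ht : t ∈ A := hB.1 (by simp)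
    rcases hst.lt_or_gt with h | h
    · exact ⟨(s, t), mem_orderedPairs.2 ⟨⟨hs, ht⟩, h⟩, rfl⟩
    · exact ⟨(t, s), mem_orderedPairs.2 ⟨⟨ht, hs⟩, h⟩, Finset.pair_comm _ _⟩

/-- In a pair containing `k`, the index `k` may come first or second, so `g` has to be symmetric on
these pairs. -/
theorem prod_orderedPairs_insert {B : Finset (Fin n)} {k : Fin n} (hk : k ∉ B)
    (g : Fin n → Fin n → ℤˣ) (hg : ∀ s ∈ B, g k s = g s k) :
    ∏ q ∈ orderedPairs (insert k B), g q.1 q.2 =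
      (∏ q ∈ orderedPairs B, g q.1 q.2) * ∏ s ∈ B, g s k := by
  have h1 : ∀ A : Finset (Fin n), ∏ q ∈ orderedPairs A, g q.1 q.2 =
      ∏ s ∈ A, ∏ t ∈ A, if s < t then g s t else 1 := fun A => by
    rw [orderedPairs, Finset.prod_filter, Finset.prod_product]
  rw [h1, h1, Finset.prod_insert hk, Finset.prod_insert hk, if_neg (lt_irrefl k), one_mul]
  have h2 : ∀ s ∈ B, (∏ t ∈ insert k B, if s < t then g s t else 1) =
      (if s < k then g s k else 1) * ∏ t ∈ B, if s < t then g s t else 1 := fun s _ =>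
    Finset.prod_insert hk
  rw [Finset.prod_congr rfl h2, Finset.prod_mul_distrib, ← mul_assoc, ← Finset.prod_mul_distrib,
    mul_comm]
  congr 1
  refine Finset.prod_congr rfl fun s hs => ?_
  have hne : s ≠ k := fun h => hk (h ▸ hs)
  rcases hne.lt_or_gt with h | h
  · rw [if_neg h.not_gt, if_pos h, one_mul]
  · rw [if_pos h, if_neg h.not_gt, mul_one, hg s hs]

/-- The product counts the values -1 modulo 2. As `A.card` is odd, the values 1 occur with the
opposite parity, which allows one formula for both `ε`. -/
theorem neg_one_pow_card_filter {ι : Type*} (A : Finset ι) (g : ι → ℤˣ)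
    (hA : Odd A.card) (ε : ℤˣ) :
    (-1 : ℤˣ) ^ (A.filter fun q => g q = ε).card = -ε * ∏ q ∈ A, g q := by
  have h1 : ∏ q ∈ A, g q = (-1 : ℤˣ) ^ (A.filter fun q => g q = -1).card := by
    rw [← Finset.prod_const, Finset.prod_filter]
    refine Finset.prod_congr rfl fun q _ => ?_
    rcases Int.units_eq_one_or (g q) with h | h <;> rw [h] <;> decide
  have h2 : (A.filter fun q => g q = 1).card + (A.filter fun q => g q = -1).card = A.card := by
    rw [← Finset.card_filter_add_card_filter_not (s := A) (fun q => g q = 1)]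
    congr 2
    refine Finset.filter_congr fun q _ => ?_
    rcases Int.units_eq_one_or (g q) with h | h <;> rw [h] <;> decide
  have h3 : (-1 : ℤˣ) ^ (A.filter fun q => g q = 1).card *
      (-1 : ℤˣ) ^ (A.filter fun q => g q = -1).card = -1 := by
    rw [← pow_add, h2, hA.neg_one_pow]
  rw [h1]
  rcases Int.units_eq_one_or ε with rfl | rfl
  · have h4 := congrArg (· * (-1 : ℤˣ) ^ (A.filter fun q => g q = -1).card) h3
    simp only [mul_assoc, Int.units_mul_self, mul_one] at h4
    exact h4
  · simp

theorem neg_one_pow_eq_iff_modEq (a b : ℕ) : (-1 : ℤˣ) ^ a = (-1) ^ b ↔ a ≡ b [MOD 2] := by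
  rcases Nat.even_or_odd a with ha | ha <;> rcases Nat.even_or_odd b with hb | hb <;>
    simp only [ha.neg_one_pow, hb.neg_one_pow, Nat.ModEq] <;>
    simp only [Nat.even_iff, Nat.odd_iff] at ha hb <;> simp [ha, hb]

/-- A cocycle of signs is a coboundary in exactly two ways. -/
theorem exists_two_potentials (hn : 3 ≤ n) (m : Fin n → Fin n → ℤˣ)
    (hm : ∀ i j k, i ≠ j → j ≠ k → i ≠ k → m i j * m j k * m i k = 1) :
    ∃ a : Fin n → ℤˣ, ∀ b : Fin n → ℤˣ,
      (∀ i j, i ≠ j → b i * b j = m i j) ↔ b = a ∨ b = -a := by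
  let z : Fin n := ⟨0, by omega⟩
  -- With a third index `k`, the cocycle conditions for `i, j, k` and `j, i, k` differ only in this
  -- factor.
  have hsymm : ∀ i j, i ≠ j → m i j = m j i := by
    intro i j hij
    obtain ⟨k, hk⟩ : ∃ k : Fin n, k ∉ ({i, j} : Finset (Fin n)) := by
      by_contra! h
      have h1 : (Finset.univ : Finset (Fin n)) ⊆ {i, j} := fun k _ => h k
      have h2 := (Finset.card_le_card h1).trans Finset.card_le_two
      rw [Finset.card_univ, Fintype.card_fin] at h2
      omega
    simp only [Finset.mem_insert, Finset.mem_singleton, not_or] at hk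
    have h1 := hm i j k hij (Ne.symm hk.2) (Ne.symm hk.1)
    have h2 := hm j i k hij.symm (Ne.symm hk.1) (Ne.symm hk.2)
    rw [mul_right_comm] at h2
    exact mul_right_cancel (mul_right_cancel (h1.trans h2.symm))
  -- A potential is propagated from its value `c` at the base index `z`; the cocycle condition on
  -- triples through `z` makes it consistent.
  have hsol : ∀ c : ℤˣ, ∀ i j, i ≠ j →
      (if i = z then c else c * m z i) * (if j = z then c else c * m z j) = m i j := by
    intro c i j hij
    have hcc : c * c = 1 := Int.units_mul_self c
    by_cases hi : i = z
    · subst hi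
      rw [if_pos rfl, if_neg hij.symm, ← mul_assoc, hcc, one_mul]
    · by_cases hj : j = z
      · subst hj
        rw [if_pos rfl, if_neg hij, mul_right_comm, hcc, one_mul, hsymm _ _ hij]
      · rw [if_neg hi, if_neg hj, mul_mul_mul_comm, hcc, one_mul]
        have h1 := hm z i j (Ne.symm hi) hij (Ne.symm hj)
        rw [mul_right_comm] at h1
        rw [mul_eq_one_iff_eq_inv.1 h1, Int.units_inv_eq_self]
  refine ⟨fun i => if i = z then 1 else 1 * m z i, fun b => ⟨fun hb => ?_, ?_⟩⟩
  · have h1 : ∀ i, b i = b z * (if i = z then 1 else 1 * m z i) := by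
      intro i
      by_cases hi : i = z
      · rw [if_pos hi, hi, mul_one]
      · rw [if_neg hi, one_mul, ← hb z i (Ne.symm hi), ← mul_assoc, Int.units_mul_self, one_mul]
    rcases Int.units_eq_one_or (b z) with h | h
    · refine Or.inl (funext fun i => ?_)
      rw [h1 i, h, one_mul]
    · refine Or.inr (funext fun i => ?_)
      rw [h1 i, h, neg_one_mul, Pi.neg_apply]
  · rintro (rfl | rfl) i j hij
    · exact hsol 1 i j hij
    · simp only [Pi.neg_apply, neg_mul_neg]
      exact hsol 1 i j hij

/-- The system of signs of an arrangement: `σ s t i` is the sign at the crossing of the curves `s`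
and `t` of the function that defines the curve `i`. -/
structure IsSignSystem (κ : Fin n → Fin n → ℤˣ) (σ : Fin n → Fin n → Fin n → ℤˣ) : Prop where
  alternate : ∀ i j k, i ≠ j → j ≠ k → i ≠ k → σ i j k = -σ i k j
  swap : ∀ i j k, i ≠ j → j ≠ k → i ≠ k → σ i j k = κ i j * σ j i k

namespace IsSignSystem

variable {κ : Fin n → Fin n → ℤˣ} {σ : Fin n → Fin n → Fin n → ℤˣ} (h : IsSignSystem κ σ)
include h

/-- Applying `swap` and `alternate` in turn leads from σ i j k through all six permutations back to
itself. Each κ is collected once and the sign -1 three times. -/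
theorem prod_kappa {i j k : Fin n} (hij : i ≠ j) (hjk : j ≠ k) (hik : i ≠ k) :
    κ i j * κ j k * κ i k = -1 := by
  have h1 := h.swap i j k hij hjk hik
  have h2 := h.alternate j i k hij.symm hik hjk
  have h3 := h.swap j k i hjk hik.symm hij.symm
  have h4 := h.alternate k j i hjk.symm hij.symm hik.symm
  have h5 := h.swap i k j hik hjk.symm hij
  have h6 := h.alternate i j k hij hjk hik
  generalize σ i j k = a at *
  generalize σ j i k = b at *
  generalize σ j k i = c at *
  generalize σ k j i = d at *
  generalize σ k i j = e at *
  generalize σ i k j = f at *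
  generalize κ i j = x at *
  generalize κ j k = y at *
  generalize κ i k = z at *
  subst h6 h2 h4 h3
  revert h1 h5
  rcases Int.units_eq_one_or x with rfl | rfl <;> rcases Int.units_eq_one_or y with rfl | rfl <;>
    rcases Int.units_eq_one_or z with rfl | rfl <;> rcases Int.units_eq_one_or e with rfl | rfl <;>
    rcases Int.units_eq_one_or f with rfl | rfl <;> decide

theorem prod_sides {i j k : Fin n} (hij : i ≠ j) (hjk : j ≠ k) (hik : i ≠ k) :
    (∏ q ∈ orderedPairs ({i, j}ᶜ : Finset (Fin n)), σ q.1 q.2 i * σ q.1 q.2 j) *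
    (∏ q ∈ orderedPairs ({j, k}ᶜ : Finset (Fin n)), σ q.1 q.2 j * σ q.1 q.2 k) *
    (∏ q ∈ orderedPairs ({i, k}ᶜ : Finset (Fin n)), σ q.1 q.2 i * σ q.1 q.2 k) =
    (-1) ^ (n - 3) := by
  set B : Finset (Fin n) := {i, j, k}ᶜ with hB
  have hmem : ∀ s ∈ B, s ≠ i ∧ s ≠ j ∧ s ≠ k := fun s hs => by simpa [hB] using hs
  have hcard : B.card = n - 3 := by
    rw [hB, Finset.card_compl, Fintype.card_fin, Finset.card_eq_three.2 ⟨i, j, k, hij, hik, hjk, rfl⟩]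
  have key : ∀ x y w : Fin n, x ≠ w → y ≠ w → w ∉ B → ({x, y}ᶜ : Finset (Fin n)) = insert w B →
      (∀ s ∈ B, s ≠ x ∧ s ≠ y ∧ s ≠ w) →
      ∏ q ∈ orderedPairs ({x, y}ᶜ : Finset (Fin n)), σ q.1 q.2 x * σ q.1 q.2 y =
      (∏ q ∈ orderedPairs B, σ q.1 q.2 x * σ q.1 q.2 y) * ∏ s ∈ B, σ s w x * σ s w y := by
    intro x y w hxw hyw hw hxy hs
    rw [hxy]
    refine prod_orderedPairs_insert hw (fun s t => σ s t x * σ s t y) fun s hsB => ?_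
    obtain ⟨h1, h2, h3⟩ := hs s hsB
    -- Exchanging the two crossing curves brings in the same κ for `x` and for `y`, so it cancels in
    -- the product.
    rw [h.swap w s x h3.symm h1 hxw.symm, h.swap w s y h3.symm h2 hyw.symm, mul_mul_mul_comm,
      Int.units_mul_self, one_mul]
  rw [key i j k hik hjk (by simp [hB]) (by ext s; by_cases hs : s = k <;> simp [hB, hs, hik.symm, hjk.symm])
      hmem,
    key j k i hij.symm hik.symm (by simp [hB])
      (by ext s; by_cases hs : s = i <;> simp [hB, hs, hij, hik])
      (fun s hs => ⟨(hmem s hs).2.1, (hmem s hs).2.2, (hmem s hs).1⟩),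
    key i k j hij hjk.symm (by simp [hB])
      (by ext s; by_cases hs : s = j <;> simp [hB, hs, hij.symm, hjk])
      (fun s hs => ⟨(hmem s hs).1, (hmem s hs).2.2, (hmem s hs).2.1⟩)]
  -- For a pair avoiding all three curves, each of its three signs occurs twice.
  have h1 : (∏ q ∈ orderedPairs B, σ q.1 q.2 i * σ q.1 q.2 j) *
      (∏ q ∈ orderedPairs B, σ q.1 q.2 j * σ q.1 q.2 k) *
      (∏ q ∈ orderedPairs B, σ q.1 q.2 i * σ q.1 q.2 k) = 1 := by
    rw [← Finset.prod_mul_distrib, ← Finset.prod_mul_distrib]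
    refine Finset.prod_eq_one fun q _ => ?_
    generalize σ q.1 q.2 i = a
    generalize σ q.1 q.2 j = b
    generalize σ q.1 q.2 k = c
    rcases Int.units_eq_one_or a with rfl | rfl <;> rcases Int.units_eq_one_or b with rfl | rfl <;>
      rcases Int.units_eq_one_or c with rfl | rfl <;> decide
  -- For each remaining curve `s`, the six signs form three pairs related by `alternate`,
  -- contributing (-1)³.
  have h2 : (∏ s ∈ B, σ s k i * σ s k j) * (∏ s ∈ B, σ s i j * σ s i k) *
      (∏ s ∈ B, σ s j i * σ s j k) = (-1) ^ (n - 3) := by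
    rw [← Finset.prod_mul_distrib, ← Finset.prod_mul_distrib, ← hcard]
    refine Finset.prod_eq_pow_card fun s hs => ?_
    obtain ⟨hsi, hsj, hsk⟩ := hmem s hs
    rw [h.alternate s k i hsk hik.symm hsi, h.alternate s k j hsk hjk.symm hsj,
      h.alternate s i j hsi hij hsj]
    generalize σ s i k = a
    generalize σ s j k = b
    generalize σ s j i = c
    rcases Int.units_eq_one_or a with rfl | rfl <;> rcases Int.units_eq_one_or b with rfl | rfl <;>
      rcases Int.units_eq_one_or c with rfl | rfl <;> decide
  rw [mul_mul_mul_mul_mul_comm, h1, h2, one_mul]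

/-- The parity conditions on the digons of all pairs of curves have exactly two solutions, which are
opposite to each other. -/
theorem exists_two_compatible (hn : Odd ((n - 2).choose 2)) :
    ∃ a : Fin n → ℤˣ, ∀ b : Fin n → ℤˣ, (∀ i j, i ≠ j →
      ((orderedPairs ({i, j}ᶜ : Finset (Fin n))).filter fun q =>
        σ q.1 q.2 i * σ q.1 q.2 j = -(κ i j * (b i * b j))).card ≡ (n - 3).choose 2 [MOD 2]) ↔
      b = a ∨ b = -a := by
  have hn4 : 4 ≤ n := by
    by_contra! hlt
    rw [Nat.choose_eq_zero_of_lt (by omega)] at hn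
    exact absurd hn (by decide)
  let E : Fin n → Fin n → ℤˣ := fun i j =>
    ∏ q ∈ orderedPairs ({i, j}ᶜ : Finset (Fin n)), σ q.1 q.2 i * σ q.1 q.2 j
  let m : Fin n → Fin n → ℤˣ := fun i j => (-1) ^ ((n - 3).choose 2) * (κ i j * E i j)
  obtain ⟨a, ha⟩ := exists_two_potentials (by omega) m (by
    intro i j k hij hjk hik
    have h1 := h.prod_kappa hij hjk hik
    have h2 : E i j * E j k * E i k = (-1) ^ (n - 3) := h.prod_sides hij hjk hik
    -- Pascal's rule combines the exponent from `prod_sides` with the one in the compatibility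
    -- condition; the hypothesis says that the sum is odd.
    have h3 : (n - 2).choose 2 = (n - 3) + (n - 3).choose 2 := by
      obtain ⟨d, rfl⟩ : ∃ d, n = d + 3 := ⟨n - 3, by omega⟩
      rw [show d + 3 - 2 = d + 1 by omega, show d + 3 - 3 = d by omega, Nat.choose_succ_succ' d 1,
        Nat.choose_one_right]
    have h4 : (-1 : ℤˣ) ^ (n - 3) * (-1) ^ ((n - 3).choose 2) = -1 := by
      rw [← pow_add, ← h3, hn.neg_one_pow]
    simp only [m]
    generalize (-1 : ℤˣ) ^ ((n - 3).choose 2) = N at *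
    rw [mul_mul_mul_mul_mul_comm, mul_mul_mul_mul_mul_comm, h1, h2, Int.units_mul_self, one_mul, mul_left_comm,
      mul_comm N, h4, neg_one_mul, neg_neg])
  refine ⟨a, fun b => ?_⟩
  rw [← ha b]
  refine forall_congr' fun i => forall_congr' fun j => forall_congr' fun hij => ?_
  -- Oddness enters a second time: it makes the parity of the chosen digon depend on its sign, and
  -- hence on `b i * b j`.
  have hodd : Odd (orderedPairs ({i, j}ᶜ : Finset (Fin n))).card := by
    rwa [card_orderedPairs, Finset.card_compl, Fintype.card_fin, Finset.card_pair hij]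
  rw [← neg_one_pow_eq_iff_modEq, neg_one_pow_card_filter _ _ hodd, neg_neg]
  change κ i j * (b i * b j) * E i j = _ ↔ b i * b j = (-1) ^ ((n - 3).choose 2) * (κ i j * E i j)
  generalize (-1 : ℤˣ) ^ ((n - 3).choose 2) = N
  generalize κ i j = x
  generalize E i j = y
  generalize b i * b j = z
  rcases Int.units_eq_one_or x with rfl | rfl <;> rcases Int.units_eq_one_or y with rfl | rfl <;>
    rcases Int.units_eq_one_or z with rfl | rfl <;> rcases Int.units_eq_one_or N with rfl | rfl <;>
    decide

end IsSignSystem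

end Combinatorics

/-! ### The sign system of an arrangement, and the theorem -/

namespace RP2

open Classical in
/-- The sign of a nonzero real number. -/
def sgn (x : ℝ) : ℤˣ := if 0 < x then 1 else -1

theorem sgn_eq_iff {x : ℝ} (hx : x ≠ 0) (ε : ℤˣ) : sgn x = ε ↔ 0 < ((ε : ℤ) : ℝ) * x := by
  rcases hx.lt_or_gt with h | h <;> rcases Int.units_eq_one_or ε with rfl | rfl
  · simp [sgn, h.not_gt]
  · simp [sgn, h.not_gt, h]
  · simp [sgn, h]
  · simp [sgn, h, h.le]

theorem sgn_mul_self_pos {x : ℝ} (hx : x ≠ 0) : 0 < ((sgn x : ℤ) : ℝ) * x :=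
  (sgn_eq_iff hx _).1 rfl

theorem sgn_mul {x y : ℝ} (hx : x ≠ 0) (hy : y ≠ 0) : sgn (x * y) = sgn x * sgn y := by
  rw [sgn_eq_iff (mul_ne_zero hx hy)]
  have := mul_pos (sgn_mul_self_pos hx) (sgn_mul_self_pos hy)
  push_cast
  linarith

theorem sgn_neg {x : ℝ} (hx : x ≠ 0) : sgn (-x) = -sgn x := by
  rw [sgn_eq_iff (neg_ne_zero.2 hx)]
  simpa using sgn_mul_self_pos hx

/-- Straightenings of the curves of an arrangement, with the parameters of their crossings:
`S i` passes through the curve `j` at the parameter `θ i j`, from the negative to the positive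
side. -/
structure CrossingParameters {n : ℕ} (L : Fin n → Set RP2) where
  S : ∀ i, Straightening (L i)
  θ : Fin n → Fin n → ℝ
  f_lift_eq : ∀ i j, i ≠ j → ∀ t, ∃ c > 0, (S j).f ((S i).lift t) = c * Real.sin (t - θ i j)

theorem _root_.IsSimpleArrangement.nonempty_crossingParameters {n : ℕ} {L : Fin n → Set RP2}
    (hL : IsSimpleArrangement L) : Nonempty (CrossingParameters L) := by
  let S : ∀ i, Straightening (L i) := fun i =>
    Classical.choice (hL.pseudoline i).nonempty_straightening
  have h : ∀ i j, ∃ θ, i ≠ j → ∀ t, ∃ c > 0,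
      (S j).f ((S i).lift t) = c * Real.sin (t - θ) := by
    intro i j
    by_cases hij : i = j
    · exact ⟨0, fun h => absurd hij h⟩
    · obtain ⟨p, hp⟩ := hL.meet_once i j hij
      obtain ⟨θ, hθ⟩ := (S i).exists_f_lift_eq (S j) hp
      exact ⟨θ, fun _ => hθ⟩
  choose θ hθ using h
  exact ⟨⟨S, θ, hθ⟩⟩

namespace CrossingParameters

variable {n : ℕ} {L : Fin n → Set RP2} (C : CrossingParameters L)

/-- A lift of the crossing of the curves `i` and `j`. -/
def crossing (i j : Fin n) : Fin 3 → ℝ := (C.S i).lift (C.θ i j)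

theorem crossing_ne_zero (i j : Fin n) : C.crossing i j ≠ 0 := (C.S i).lift_ne_zero _

theorem f_crossing_right {i j : Fin n} (hij : i ≠ j) : (C.S j).f (C.crossing i j) = 0 := by
  obtain ⟨c, -, hc⟩ := C.f_lift_eq i j hij (C.θ i j)
  rw [crossing, hc, sub_self, Real.sin_zero, mul_zero]

theorem pt_crossing_mem {i j : Fin n} (hij : i ≠ j) : pt (C.crossing i j) ∈ L i ∩ L j :=
  ⟨(C.S i).curve_mem _, ((C.S j).pt_mem_iff (C.crossing_ne_zero i j)).2 (C.f_crossing_right hij)⟩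

/-- The sign of the defining function of the curve `k` at the crossing of `i` and `j`. -/
def sign (i j k : Fin n) : ℤˣ := sgn ((C.S k).f (C.crossing i j))

variable (hL : IsSimpleArrangement L)
include hL

theorem inter_eq {i j : Fin n} (hij : i ≠ j) : L i ∩ L j = {pt (C.crossing i j)} := by
  obtain ⟨p, hp⟩ := hL.meet_once i j hij
  have h := C.pt_crossing_mem hij
  rw [hp] at h ⊢
  rw [mem_singleton_iff.1 h]

theorem f_crossing_ne_zero {i j k : Fin n} (hij : i ≠ j) (hjk : j ≠ k) (hik : i ≠ k) :
    (C.S k).f (C.crossing i j) ≠ 0 := by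
  intro h
  have h1 : pt (C.crossing i j) ∈ L i ∩ L j ∩ L k :=
    ⟨C.pt_crossing_mem hij, ((C.S k).pt_mem_iff (C.crossing_ne_zero i j)).2 h⟩
  rw [hL.simple i j k hij hjk hik] at h1
  exact h1

theorem exists_crossing_eq_smul {i j : Fin n} (hij : i ≠ j) :
    ∃ r : ℝ, r ≠ 0 ∧ C.crossing i j = r • C.crossing j i := by
  refine exists_smul_of_pt_eq (C.crossing_ne_zero i j) (C.crossing_ne_zero j i) ?_
  have h := C.inter_eq hL hij
  rw [inter_comm, C.inter_eq hL hij.symm] at h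
  exact (singleton_injective h).symm

/-- Alternation holds because both values lie on the same curve λ_i: they are positive multiples of
sin(θ_ij - θ_ik) and sin(θ_ik - θ_ij). The swap rule is homogeneity of the defining function,
applied to the two lifts of one crossing. -/
theorem isSignSystem : ∃ κ, IsSignSystem κ C.sign ∧ ∀ i j, i ≠ j →
    ∃ r : ℝ, r ≠ 0 ∧ C.crossing i j = r • C.crossing j i ∧ κ i j = sgn r := by
  have h : ∀ i j, ∃ κ : ℤˣ, i ≠ j →
      ∃ r : ℝ, r ≠ 0 ∧ C.crossing i j = r • C.crossing j i ∧ κ = sgn r := by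
    intro i j
    by_cases hij : i = j
    · exact ⟨1, fun h => absurd hij h⟩
    · obtain ⟨r, hr, h⟩ := C.exists_crossing_eq_smul hL hij
      exact ⟨sgn r, fun _ => ⟨r, hr, h, rfl⟩⟩
  choose κ hκ using h
  refine ⟨κ, ⟨fun i j k hij hjk hik => ?_, fun i j k hij hjk hik => ?_⟩, hκ⟩
  · have h1 := C.f_crossing_ne_zero hL hij hjk hik
    have h2 := C.f_crossing_ne_zero hL hik hjk.symm hij
    obtain ⟨c, hc, hc1⟩ := C.f_lift_eq i k hik (C.θ i j)
    obtain ⟨d, hd, hd1⟩ := C.f_lift_eq i j hij (C.θ i k)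
    have hneg : Real.sin (C.θ i k - C.θ i j) = -Real.sin (C.θ i j - C.θ i k) := by
      rw [← Real.sin_neg, neg_sub]
    rw [sign, sign, ← sgn_neg h2, sgn_eq_iff h1]
    have h3 := sgn_mul_self_pos (neg_ne_zero.2 h2)
    change 0 < ((sgn _ : ℤ) : ℝ) * (C.S k).f ((C.S i).lift _)
    generalize ((sgn (-(C.S j).f (C.crossing i k)) : ℤ) : ℝ) = e at *
    change 0 < e * -(C.S j).f ((C.S i).lift _) at h3
    rw [hc1]
    rw [hd1, hneg, mul_neg d, neg_neg] at h3
    have h4 : e * (c * Real.sin (C.θ i j - C.θ i k)) =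
        (e * (d * Real.sin (C.θ i j - C.θ i k))) * (c / d) := by field_simp
    rw [h4]
    exact mul_pos h3 (div_pos hc hd)
  · obtain ⟨r, hr, hr1, hr2⟩ := hκ i j hij
    rw [sign, sign, hr1, (C.S k).f_smul, hr2,
      sgn_mul hr (C.f_crossing_ne_zero hL hij.symm hik hjk)]

theorem crossingCount_side (i j : Fin n) (ε : ℤˣ) :
    crossingCount L i j ((C.S i).side (C.S j) ε) =
      ((orderedPairs ({i, j}ᶜ : Finset (Fin n))).filter fun q =>
        C.sign q.1 q.2 i * C.sign q.1 q.2 j = ε).card := by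
  unfold crossingCount
  congr 1
  ext ⟨s, t⟩
  simp only [Finset.mem_filter, Finset.mem_univ, true_and, mem_orderedPairs, Finset.mem_compl,
    Finset.mem_insert, Finset.mem_singleton, not_or]
  have key : s < t → s ≠ i → s ≠ j → t ≠ i → t ≠ j →
      (L s ∩ L t ⊆ (C.S i).side (C.S j) ε ↔ C.sign s t i * C.sign s t j = ε) := by
    intro hst hsi hsj hti htj
    have h1 := C.f_crossing_ne_zero hL hst.ne hti hsi
    have h2 := C.f_crossing_ne_zero hL hst.ne htj hsj
    rw [C.inter_eq hL hst.ne, singleton_subset_iff, Straightening.pt_mem_side _ _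
      (C.crossing_ne_zero s t), sign, sign, ← sgn_mul h1 h2, sgn_eq_iff (mul_ne_zero h1 h2)]
  constructor
  · rintro ⟨hst, hsi, hsj, hti, htj, h⟩
    exact ⟨⟨⟨⟨hsi, hsj⟩, hti, htj⟩, hst⟩, (key hst hsi hsj hti htj).1 h⟩
  · rintro ⟨⟨⟨⟨hsi, hsj⟩, hti, htj⟩, hst⟩, h⟩
    exact ⟨hst, hsi, hsj, hti, htj, (key hst hsi hsj hti htj).2 h⟩

/-- Exactly one of the two digons carries an induced boundary orientation, so the existential in
`CompatibleAt` becomes a condition on the digon of sign `-(sgn r * (b i * b j))`. -/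
theorem compatibleAt_iff {i j : Fin n} (hij : i ≠ j) {r : ℝ} (hr : r ≠ 0)
    (hcr : C.crossing i j = r • C.crossing j i) (b : Fin n → ℤˣ) :
    CompatibleAt L (fun i => (C.S i).orient (b i)) i j ↔
      ((orderedPairs ({i, j}ᶜ : Finset (Fin n))).filter fun q =>
        C.sign q.1 q.2 i * C.sign q.1 q.2 j = -(sgn r * (b i * b j))).card ≡
          (n - 3).choose 2 [MOD 2] := by
  have hi := C.inter_eq hL hij
  have hp : pt (C.crossing i j) ∈ L i ∩ L j := C.pt_crossing_mem hij
  have hη : (C.S j).curve (C.θ j i) = pt (C.crossing i j) := by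
    rw [hcr, pt_smul hr]
    rfl
  have hind : ∀ ε, InducesBoundaryOrientation ((C.S i).orient (b i)) ((C.S j).orient (b j))
      ((C.S i).side (C.S j) ε) ↔ ε = -(sgn r * (b i * b j)) := by
    intro ε
    rw [(C.S i).inducesBoundaryOrientation_iff (C.S j) hi rfl hη (hL.transversal i j hij _ hp) hr
      hcr (C.f_lift_eq j i hij.symm) (C.f_lift_eq i j hij)]
    have h1 : sgn r = -(ε * (b i * b j)) ↔ ε = -(sgn r * (b i * b j)) := by
      generalize sgn r = x
      generalize b i * b j = y
      rcases Int.units_eq_one_or x with rfl | rfl <;> rcases Int.units_eq_one_or y with rfl | rfl <;>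
        rcases Int.units_eq_one_or ε with rfl | rfl <;> decide
    rw [← h1, sgn_eq_iff hr]
    push_cast
    constructor <;> intro h <;> linarith
  have hdig := (C.S i).isDigon_iff (C.S j) (C.f_lift_eq j i hij.symm)
  constructor
  · rintro ⟨D, hD, hDo, hDc⟩
    obtain ⟨ε, rfl⟩ := (hdig D).1 hD
    rw [C.crossingCount_side hL i j, (hind ε).1 hDo] at hDc
    exact hDc
  · intro h
    refine ⟨_, (hdig _).2 ⟨-(sgn r * (b i * b j)), rfl⟩, (hind _).2 rfl, ?_⟩
    rw [C.crossingCount_side hL i j]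
    exact h

theorem exists_isCompatible_iff (hn : Odd ((n - 2).choose 2)) : ∃ a : Fin n → ℤˣ,
    ∀ b : Fin n → ℤˣ, IsCompatible L (fun i => (C.S i).orient (b i)) ↔ b = a ∨ b = -a := by
  obtain ⟨κ, hκ, hκr⟩ := C.isSignSystem hL
  obtain ⟨a, ha⟩ := hκ.exists_two_compatible hn
  refine ⟨a, fun b => ?_⟩
  rw [← ha b]
  refine forall_congr' fun i => forall_congr' fun j => forall_congr' fun hij => ?_
  obtain ⟨r, hr, hcr, hk⟩ := hκr i j hij
  rw [hk]
  exact C.compatibleAt_iff hL hij hr hcr b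

end CrossingParameters
end RP2
end

theorem theorem5 (n : ℕ) (L : Fin n → Set RP2) (hL : IsSimpleArrangement L)
    (hn : Odd ((n - 2).choose 2)) :
    {o : ∀ i, CurveOrientation (L i) | IsCompatible L o}.encard = 2 ∧
    ∀ o o' : ∀ i, CurveOrientation (L i), IsCompatible L o → IsCompatible L o' → o ≠ o' →
      ∀ (i : Fin n) (p : L i), (o' i).dir p = -(o i).dir p := by
  obtain ⟨C⟩ := hL.nonempty_crossingParameters
  obtain ⟨a, ha⟩ := C.exists_isCompatible_iff hL hn
  let O : (Fin n → ℤˣ) → ∀ i, CurveOrientation (L i) := fun b i => (C.S i).orient (b i)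
  have hsurj : ∀ o : ∀ i, CurveOrientation (L i), ∃ b, o = O b := fun o => by
    choose b hb using fun i => (C.S i).exists_orient_eq (o i)
    exact ⟨b, funext hb⟩
  have hiff : ∀ o : ∀ i, CurveOrientation (L i), IsCompatible L o ↔ o = O a ∨ o = O (-a) := by
    intro o
    constructor
    · intro h
      obtain ⟨b, rfl⟩ := hsurj o
      exact ((ha b).1 h).imp (congrArg O) (congrArg O)
    · rintro (rfl | rfl)
      · exact (ha a).2 (Or.inl rfl)
      · exact (ha (-a)).2 (Or.inr rfl)
  -- At least one curve is needed to tell the two families of orientations apart.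
  have hpos : 0 < n := by
    rcases Nat.eq_zero_or_pos n with rfl | h
    · exact absurd hn (by decide)
    · exact h
  have hne : O a ≠ O (-a) := by
    intro h
    have h1 := (C.S ⟨0, hpos⟩).orient_injective (congrFun h ⟨0, hpos⟩)
    exact units_ne_neg_self _ h1
  refine ⟨?_, fun o o' ho ho' hoo' i p => ?_⟩
  · have hset : {o : ∀ i, CurveOrientation (L i) | IsCompatible L o} = {O a, O (-a)} := by
      ext o
      exact hiff o
    rw [hset, encard_pair hne]
  · rcases (hiff o).1 ho with rfl | rfl <;> rcases (hiff o').1 ho' with rfl | rfl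
    · exact absurd rfl hoo'
    · exact (C.S i).orient_neg_dir _ p
    · have := (C.S i).orient_neg_dir (a i) p
      change ((C.S i).orient (a i)).dir p = -((C.S i).orient (-a i)).dir p
      rw [this, neg_neg]
    · exact absurd rfl hoo'
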